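/- Let $Sm/\mathbb C$ be the category of smooth schemes of finite type over $\mathbb C$ with the Nisnevich topology. For a presheaf of sets $\mathcal F$ on $Sm/\mathbb C$, call $x_0,x_1\in\mathcal F(U)$ $\mathbb A^1$-homotopic if there is $h\in\mathcal F(\mathbb A^1\times U)$ whose restrictions along the sections $u\mapsto(0,u)$ and $u\mapsto(1,u)$ are $x_0$ and $x_1$. Let $\mathcal S(\mathcal F)$ be the Nisnevich sheafification of the presheaf $U\mapsto\mathcal F(U)/\!\sim$, where $\sim$ is the equivalence relation generated by $\mathbb A^1$-homotopy, and let $\mathcal S^m$ be the $m$-fold iterate of $\mathcal S$. A $\mathbb C$-scheme is identified with the sheaf on $Sm/\mathbb C$ that it defines. For a field extension $k/\mathbb C$, put $\mathcal F(k):=\operatorname{colim}\mathcal F(U)$, the colimit over all $U\in Sm/\mathbb C$ equipped with a $\mathbb C$-morphism $\operatorname{Spec}k\to U$; if $k/\mathbb C$ is finitely generated, this is the stalk of $\mathcal F$ at the generic point of any smooth model of $k$. Let $\lambda_1,\lambda_2,\lambda_3\in\mathbb C\setminus\{0\}$ and $f(x)=(x-\lambda_1)(x-\lambda_2)(x-\lambda_3)$.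 Put $X_0=\mathbb A^1_{\mathbb C}$ and $$Y_1=\operatorname{Spec}\mathbb C[x_0,x_1,y_1]/\langle y_1^2-x_0^2f(x_1)\rangle,\qquad X_1=Y_1\setminus\{(0,0,0)\},$$ and let $\phi_1,\psi_1:X_1\to X_0$ be the projections to the $x_0$-axis and the $x_1$-axis. For $n\ge 2$ define inductively $$X_n=X_{n-1}\times_{\psi_{n-1},\,X_{n-2},\,\phi_{n-1}}X_{n-1},$$ with $\phi_n,\psi_n:X_n\to X_{n-1}$ the first and the second projection. **Theorem.** For every finitely generated field extension $k$ of $\mathbb C$ and every $n\ge 1$, the set $\mathcal S^{n+1}(X_n)(k)$ consists of exactly one point. -/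

import Mathlib

open CategoryTheory CategoryTheory.Limits AlgebraicGeometry Opposite

universe u

noncomputable section

namespace NaiveA1

section Site

variable (K : Type u) [Field K]

/-- Smooth morphisms of finite type. -/
def smoothFiniteType : MorphismProperty Scheme.{u} := fun _ _ f => Smooth f ∧ QuasiCompact f

/-- The category `Sm/K` of smooth schemes of finite type over a field `K`, with all `K`-morphisms
between them. -/
abbrev Sm : Type (u + 1) := smoothFiniteType.{u}.Over ⊤ (Spec (CommRingCat.of K))

/-- The inclusion of `Sm/K` into the category of all `K`-schemes. -/
abbrev Sm.incl : Sm K ⥤ Over (Spec (CommRingCat.of K)) := MorphismProperty.Over.forget _ _ _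

variable {K}

lemma exists_point_of_lift {V U : Scheme.{u}} (f : V ⟶ U) (u : U)
    (s : Spec (U.residueField u) ⟶ V) (hs : s ≫ f = U.fromSpecResidueField u) :
    ∃ v : V, f v = u ∧ Function.Bijective (f.residueFieldMap v) := by
  let x : Spec (U.residueField u) := IsLocalRing.closedPoint (U.residueField u)
  refine ⟨s x, ?_, ?_⟩
  · rw [← Scheme.Hom.comp_apply, hs]
    exact Scheme.fromSpecResidueField_apply u _
  · have h1 := Scheme.descResidueField_stalkClosedPointTo_comp (f := f) (K := U.residueField u) s
    have h2 := (Scheme.SpecToEquivOfField (U.residueField u) U).apply_symm_apply ⟨u, 𝟙 _⟩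
    have h3 : (Scheme.SpecToEquivOfField (U.residueField u) U).symm ⟨u, 𝟙 _⟩ = s ≫ f := by
      rw [hs]
      change Spec.map (𝟙 _) ≫ U.fromSpecResidueField u = _
      rw [Spec.map_id]
      exact Category.id_comp _
    rw [h3, Scheme.SpecToEquivOfField_eq_iff] at h2
    obtain ⟨e, he⟩ := h2
    obtain ⟨d, hd⟩ : ∃ d : V.residueField (s x) ⟶ U.residueField u,
        f.residueFieldMap (s x) ≫ d = (U.residueFieldCongr e).hom :=
      ⟨_, (h1.symm.trans he).trans (Category.comp_id _)⟩
    have hiso : IsIso (f.residueFieldMap (s x) ≫ d) := by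
      rw [hd]; exact (U.residueFieldCongr e).isIso_hom
    have hbij := (ConcreteCategory.isIso_iff_bijective _).1 hiso
    replace hbij : Function.Bijective (d ∘ f.residueFieldMap (s x)) := hbij
    refine ⟨hbij.1.of_comp, ?_⟩
    intro y
    obtain ⟨z, hz⟩ := hbij.2 (d.hom y)
    exact ⟨z, RingHom.injective _ hz⟩

lemma exists_lift_of_point {V U : Scheme.{u}} (f : V ⟶ U) (v : V)
    (h : Function.Bijective (f.residueFieldMap v)) :
    ∃ s : Spec (U.residueField (f v)) ⟶ V, s ≫ f = U.fromSpecResidueField (f v) := by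
  have : IsIso (f.residueFieldMap v) := (ConcreteCategory.isIso_iff_bijective _).2 h
  refine ⟨Spec.map (inv (f.residueFieldMap v)) ≫ V.fromSpecResidueField v, ?_⟩
  rw [Category.assoc, ← Scheme.Hom.SpecMap_residueFieldMap_fromSpecResidueField,
    ← Category.assoc, ← Spec.map_comp]
  simp

lemma quasiCompact_hom {V U : Sm K} (f : V ⟶ U) : QuasiCompact f.left := by
  have : Smooth U.hom := U.prop.1
  have : IsLocallyNoetherian ((Functor.fromPUnit (Spec (CommRingCat.of K))).obj U.right) :=
    inferInstanceAs (IsLocallyNoetherian (Spec (CommRingCat.of K)))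
  have : IsLocallyNoetherian U.left := LocallyOfFiniteType.isLocallyNoetherian U.hom
  have : QuasiCompact V.hom := V.prop.2
  have : QuasiCompact (f.left ≫ U.hom) := by
    rw [MorphismProperty.Over.w]; infer_instance
  exact QuasiCompact.of_comp f.left U.hom

variable (K)

/-- The Nisnevich topology on `Sm/K`. A sieve on `U` is covering iff every point `u` of `U` is the
image of a point `v` with the same residue field under some étale morphism `V ⟶ U` of the sieve. -/
def nisnevich : GrothendieckTopology (Sm K) where
  sieves U := {S | ∀ u : U.left, ∃ (V : Sm K) (f : V ⟶ U), S f ∧ Etale f.left ∧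
    ∃ v : V.left, f.left v = u ∧ Function.Bijective (f.left.residueFieldMap v)}
  top_mem' U u := ⟨U, 𝟙 U, trivial, (inferInstance : Etale (𝟙 U.left)), by
    refine exists_point_of_lift (𝟙 U.left) u (U.left.fromSpecResidueField u) (Category.comp_id _)⟩
  pullback_stable' := by
    intro U U' S g hS u'
    obtain ⟨V, f, hf, het, v, hv, hbij⟩ := hS (g.left u')
    obtain ⟨s, hs⟩ := exists_lift_of_point f.left v hbij
    have hsm : Smooth U'.hom := U'.prop.1
    have hqc : QuasiCompact U'.hom := U'.prop.2
    have := quasiCompact_hom f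
    let P : Sm K := MorphismProperty.Over.mk ⊤ (pullback.snd f.left g.left ≫ U'.hom)
      ⟨inferInstance, inferInstance⟩
    let p : P ⟶ U' := MorphismProperty.Over.homMk (pullback.snd f.left g.left) rfl trivial
    let q : P ⟶ V := MorphismProperty.Over.homMk (pullback.fst f.left g.left) (by
      change pullback.fst f.left g.left ≫ V.hom = pullback.snd f.left g.left ≫ U'.hom
      rw [← MorphismProperty.Over.w f, ← MorphismProperty.Over.w g,
        pullback.condition_assoc]) trivial
    have hpq : p ≫ g = q ≫ f := by
      apply MorphismProperty.Over.Hom.ext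
      exact pullback.condition.symm
    refine ⟨P, p, ?_, (inferInstance : Etale (pullback.snd f.left g.left)), ?_⟩
    · change S (p ≫ g)
      rw [hpq]
      exact S.downward_closed hf q
    · let t : Spec (U'.left.residueField u') ⟶ V.left :=
        Spec.map (g.left.residueFieldMap u') ≫
          Spec.map (U.left.residueFieldCongr hv).hom ≫ s
      have ht : t ≫ f.left = U'.left.fromSpecResidueField u' ≫ g.left := by
        simp only [t, Category.assoc, hs]
        simp
      exact exists_point_of_lift (pullback.snd f.left g.left) u'
        (pullback.lift t (U'.left.fromSpecResidueField u') ht) (pullback.lift_snd _ _ _)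
  transitive' := by
    intro U S hS R hR u
    obtain ⟨V, f, hf, het, v, rfl, hbij⟩ := hS u
    obtain ⟨W, g, hg, het', w, rfl, hbij'⟩ := hR hf v
    refine ⟨W, g ≫ f, hg, (inferInstance : Etale (g.left ≫ f.left)), w, rfl, ?_⟩
    change Function.Bijective ((g.left ≫ f.left).residueFieldMap w)
    rw [Scheme.residueFieldMap_comp]
    exact hbij'.comp hbij

end Site

section AffineLine

lemma smooth_affineLine (S : Scheme.{u}) : Smooth (𝔸(PUnit.{u + 1}; S) ↘ S) := by
  have h1 : Smooth (Spec.map (CommRingCat.ofHom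
      (MvPolynomial.C : ULift.{u} ℤ →+* MvPolynomial PUnit.{u + 1} (ULift.{u} ℤ)))) := by
    rw [HasRingHomProperty.Spec_iff (P := @Smooth), RingHom.Smooth]
    convert! (⟨inferInstance, inferInstance⟩ :
      Algebra.Smooth (ULift.{u} ℤ) (MvPolynomial PUnit.{u + 1} (ULift ℤ)))
    exact Algebra.algebra_ext _ _ fun _ ↦ rfl
  have h2 := isIso_of_isTerminal specULiftZIsTerminal.{u} terminalIsTerminal (terminal.from _)
  have h3 : Smooth (terminal.from
      (Spec (CommRingCat.of (MvPolynomial PUnit.{u + 1} (ULift.{u} ℤ))))) := by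
    rw [← terminal.comp_from (Spec.map (CommRingCat.ofHom
      (MvPolynomial.C : ULift.{u} ℤ →+* MvPolynomial PUnit.{u + 1} (ULift.{u} ℤ))))]
    infer_instance
  exact (inferInstance : Smooth (pullback.fst (terminal.from S) (terminal.from
    (Spec (CommRingCat.of (MvPolynomial PUnit.{u + 1} (ULift.{u} ℤ)))))))

variable {K : Type u} [Field K]

/-- `𝔸¹ × U`, as an object of `Sm/K`. -/
def lineTimes (U : Sm K) : Sm K :=
  MorphismProperty.Over.mk ⊤ ((𝔸(PUnit.{u + 1}; U.left) ↘ U.left) ≫ U.hom) (by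
    have := smooth_affineLine U.left
    have h1 : Smooth U.hom := U.prop.1
    have h2 : QuasiCompact U.hom := U.prop.2
    exact ⟨inferInstance, inferInstance⟩)

/-- The morphism `id × f : 𝔸¹ × U ⟶ 𝔸¹ × V`. -/
def lineTimesMap {U V : Sm K} (f : U ⟶ V) : lineTimes U ⟶ lineTimes V :=
  MorphismProperty.Over.homMk (AffineSpace.map PUnit.{u + 1} f.left) (by
    change AffineSpace.map PUnit.{u + 1} f.left ≫ (𝔸(PUnit.{u + 1}; V.left) ↘ V.left) ≫ V.hom =
      (𝔸(PUnit.{u + 1}; U.left) ↘ U.left) ≫ U.hom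
    rw [AffineSpace.map_over_assoc, MorphismProperty.Over.w f]) trivial

/-- The constant function on a `K`-scheme with value `t ∈ K`. -/
def constFun {X : Scheme.{u}} (f : X ⟶ Spec (CommRingCat.of K)) (t : K) : Γ(X, ⊤) :=
  f.appTop ((Scheme.ΓSpecIso (CommRingCat.of K)).inv t)

/-- The section `s_t : U ⟶ 𝔸¹ × U`, `u ↦ (t, u)`. -/
def lineSection (U : Sm K) (t : K) : U ⟶ lineTimes U :=
  MorphismProperty.Over.homMk
    (AffineSpace.homOfVector (𝟙 U.left) fun _ => constFun U.hom t) (by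
    change AffineSpace.homOfVector (𝟙 U.left) _ ≫
      (𝔸(PUnit.{u + 1}; U.left) ↘ U.left) ≫ U.hom = U.hom
    rw [AffineSpace.homOfVector_over_assoc, Category.id_comp]) trivial

lemma lineSection_naturality {U V : Sm K} (f : U ⟶ V) (t : K) :
    lineSection U t ≫ lineTimesMap f = f ≫ lineSection V t := by
  apply MorphismProperty.Over.Hom.ext
  change AffineSpace.homOfVector (𝟙 U.left) _ ≫ AffineSpace.map PUnit.{u + 1} f.left =
    f.left ≫ AffineSpace.homOfVector (𝟙 V.left) _
  apply AffineSpace.hom_ext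
  · simp
  · intro i
    have hw : f.left ≫ V.hom = U.hom := MorphismProperty.Over.w f
    have e1 : (AffineSpace.homOfVector (𝟙 U.left) fun _ => constFun U.hom t).appTop
        (AffineSpace.coord U.left i) = constFun U.hom t :=
      AffineSpace.homOfVector_appTop_coord _ _ _
    have e2 : (AffineSpace.homOfVector (𝟙 V.left) fun _ => constFun V.hom t).appTop
        (AffineSpace.coord V.left i) = constFun V.hom t :=
      AffineSpace.homOfVector_appTop_coord _ _ _
    rw [Scheme.Hom.comp_appTop, Scheme.Hom.comp_appTop, ConcreteCategory.comp_apply,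
      ConcreteCategory.comp_apply, AffineSpace.map_appTop_coord, e1, e2, constFun, constFun, ← hw,
      Scheme.Hom.comp_appTop, ConcreteCategory.comp_apply]

end AffineLine

section NaiveComponents

variable {K : Type u} [Field K]

/-- `x₀, x₁ ∈ F(U)` are `𝔸¹`-homotopic if some `h ∈ F(𝔸¹ × U)` has `h(0) = x₀` and
`h(1) = x₁`. -/
def IsHomotopic (F : (Sm K)ᵒᵖ ⥤ Type (u + 1)) (U : Sm K) (x₀ x₁ : F.obj (op U)) : Prop :=
  ∃ h : F.obj (op (lineTimes U)),
    F.map (lineSection U 0).op h = x₀ ∧ F.map (lineSection U 1).op h = x₁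

lemma IsHomotopic.map {F : (Sm K)ᵒᵖ ⥤ Type (u + 1)} {U V : Sm K} (f : V ⟶ U)
    {x₀ x₁ : F.obj (op U)} (h : IsHomotopic F U x₀ x₁) :
    IsHomotopic F V (F.map f.op x₀) (F.map f.op x₁) := by
  obtain ⟨h, rfl, rfl⟩ := h
  refine ⟨F.map (lineTimesMap f).op h, ?_, ?_⟩ <;>
  · rw [← ConcreteCategory.comp_apply, ← ConcreteCategory.comp_apply, ← F.map_comp, ← F.map_comp,
      ← op_comp, ← op_comp, lineSection_naturality]

/-- The presheaf `U ↦ F(U)/∼`, where `∼` is the equivalence relation generated by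
`𝔸¹`-homotopy. -/
def naivePre (F : (Sm K)ᵒᵖ ⥤ Type (u + 1)) : (Sm K)ᵒᵖ ⥤ Type (u + 1) where
  obj U := Quot (IsHomotopic F U.unop)
  map f := TypeCat.ofHom (Quot.map (F.map f) fun _ _ h => h.map f.unop)
  map_id U := by
    ext ⟨x⟩
    change Quot.mk _ (F.map (𝟙 U) x) = Quot.mk _ x
    simp
  map_comp f g := by
    ext ⟨x⟩
    change Quot.mk _ (F.map (f ≫ g) x) = Quot.mk _ (F.map g (F.map f x))
    simp

/-- The sheaf `𝒮(F)` of naive `𝔸¹`-connected components: the Nisnevich sheafification of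
`U ↦ F(U)/∼`. -/
def naiveComponents (F : (Sm K)ᵒᵖ ⥤ Type (u + 1)) : (Sm K)ᵒᵖ ⥤ Type (u + 1) :=
  sheafify (nisnevich K) (naivePre F)

/-- The functor of points `U ↦ Hom_K(U, X)` on `Sm/K` of a `K`-scheme `X`. -/
def functorOfPoints (X : Over (Spec (CommRingCat.of K))) : (Sm K)ᵒᵖ ⥤ Type (u + 1) :=
  (Sm.incl K).op ⋙ yoneda.obj X ⋙ uliftFunctor.{u + 1}

/-- The value `F(k)` at a field extension `k/K`: the colimit of `F(U)` over all `U` in `Sm/K`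
equipped with a `K`-morphism `Spec k ⟶ U`. For `k/K` finitely generated and separable this is the
colimit of `F(U)` over the smooth models `U` of `k`, that is, the stalk of `F` at the generic point
of any such model. -/
def valueAtField (F : (Sm K)ᵒᵖ ⥤ Type (u + 1)) (k : Type u) [Field k] [Algebra K k] :
    Type (u + 1) :=
  colimit ((StructuredArrow.proj
    (Over.mk (Spec.map (CommRingCat.ofHom (algebraMap K k)))) (Sm.incl K)).op ⋙ F)

end NaiveComponents

section Varieties

/-- The base `Spec ℂ`. -/
abbrev base : Scheme.{0} := Spec (CommRingCat.of ℂ)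

/-- The affine line `X₀` over `ℂ`. -/
def X₀ : Over base := Over.mk (𝔸(PUnit.{1}; base) ↘ base)

variable (l : Fin 3 → ℂ)

/-- The polynomial `y₁² - x₀² (x₁ - λ₁) (x₁ - λ₂) (x₁ - λ₃)`; the variables `x₀, x₁, y₁` are
numbered `0, 1, 2`. -/
def surfacePoly : MvPolynomial (Fin 3) ℂ :=
  .X 2 ^ 2 - .X 0 ^ 2 * ∏ i, (.X 1 - .C (l i))

/-- The coordinate ring of the surface `Y₁`. -/
abbrev SurfaceRing : Type := MvPolynomial (Fin 3) ℂ ⧸ Ideal.span {surfacePoly l}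

/-- The coordinate functions on `Y₁`. -/
def surfaceCoord (i : Fin 3) : SurfaceRing l := Ideal.Quotient.mk _ (.X i)

/-- The affine surface `Y₁ ⊆ 𝔸³`. -/
abbrev Y₁ : Scheme.{0} := Spec (CommRingCat.of (SurfaceRing l))

/-- The structure morphism of `Y₁`. -/
def Y₁ToBase : Y₁ l ⟶ base := Spec.map (CommRingCat.ofHom (algebraMap ℂ (SurfaceRing l)))

/-- The morphism `Y₁ ⟶ 𝔸¹` given by the coordinate with index `i`. -/
def Y₁ToLine (i : Fin 3) : Y₁ l ⟶ 𝔸(PUnit.{1}; base) :=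
  AffineSpace.homOfVector (Y₁ToBase l) fun _ =>
    (Scheme.ΓSpecIso (CommRingCat.of (SurfaceRing l))).inv (surfaceCoord l i)

/-- The open complement of the origin `V(x₀, x₁, y₁)` in `Y₁`. -/
def puncturedOpens : (Y₁ l).Opens :=
  ⟨(PrimeSpectrum.zeroLocus (Set.range (surfaceCoord l)))ᶜ,
    (PrimeSpectrum.isClosed_zeroLocus _).isOpen_compl⟩

/-- The surface `X₁ = Y₁ ∖ {(0,0,0)}` over `ℂ`. -/
def X₁ : Over base := Over.mk ((puncturedOpens l).ι ≫ Y₁ToBase l)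

/-- The coordinate with index `i`, as a morphism `X₁ ⟶ X₀` over `ℂ`. -/
def coordMap (i : Fin 3) : X₁ l ⟶ X₀ :=
  Over.homMk ((puncturedOpens l).ι ≫ Y₁ToLine l i) (by
    change ((puncturedOpens l).ι ≫ Y₁ToLine l i) ≫ (𝔸(PUnit.{1}; base) ↘ base) =
      (puncturedOpens l).ι ≫ Y₁ToBase l
    rw [Category.assoc, Y₁ToLine, AffineSpace.homOfVector_over])

/-- A pair of parallel morphisms of `ℂ`-schemes. -/
structure Stage where
  /-- The source of both morphisms. -/
  src : Over base
  /-- The target of both morphisms. -/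
  tgt : Over base
  /-- The first morphism. -/
  φ : src ⟶ tgt
  /-- The second morphism. -/
  ψ : src ⟶ tgt

/-- The pairs `φₙ₊₁, ψₙ₊₁ : Xₙ₊₁ ⟶ Xₙ`. For `n = 0` these are the projections of `X₁` to the
`x₀`-axis and the `x₁`-axis; then `Xₙ₊₂` is the fibre product of `ψₙ₊₁` and `φₙ₊₁`, with
projections `φₙ₊₂` (first factor) and `ψₙ₊₂` (second factor). -/
def stage : ℕ → Stage
  | 0 => ⟨X₁ l, X₀, coordMap l 0, coordMap l 1⟩
  | n + 1 =>
    let s := stage n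
    ⟨pullback s.ψ s.φ, s.src, pullback.fst s.ψ s.φ, pullback.snd s.ψ s.φ⟩

/-- The `ℂ`-scheme `Xₙ`, of dimension `n + 1`. -/
def X (n : ℕ) : Over base := (stage l n).tgt

end Varieties

end NaiveA1

end

/-! A `T`-point of `X l n` is a chain `(x₀,…,xₙ; y₁,…,yₙ)` with `yᵢ² = xᵢ₋₁² f(xᵢ)` and no common
zero of `xᵢ₋₁` and `xᵢ` (`exists_chain_bijection`). The proof compares chains by induction on `n`,
each step costing one application of `𝒮`. For `n = 0` a straight line joins any two points.

For the step, let `q` be a chain of length `n` with first entry `x₁`, and consider the ways to put a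
pair `(x₀, y₁)` in front of it. Where `x₁` is invertible, the equation is homogeneous in `(x₀, y₁)`
and `x₀` may vanish, so scaling the pair to `(0, 0)` identifies all choices (`cls_eq_of_isUnit`).
Near a zero of `x₁`, `x₀` must be a unit `a` and `y₁ = a w` with `w² = f(x₁)`. Since `f(0) = -λ₁λ₂λ₃
≠ 0`, such a root exists Nisnevich locally and is determined by its value `c = ±√f(0)` at the zero.
For fixed `c`, these local prolongations therefore glue in the sheaf `𝒮` to a morphism `σ : G × 𝔾ₘ ×
Xₙ ⟶ 𝒮(G × Xₙ₊₁)`, `(g, a, q) ↦ [g, prolongation of q]` (`exists_prolongation_hom`).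

Locally every chain arises by `σ` from its tail, for some `c` and `a` (`exists_prolongs_tail`). The
base chain with all `xᵢ = 1` arises for every `c` and `a`, because its `x₁` is invertible. By
induction the two tails agree in `𝒮ⁿ⁺¹(G × 𝔾ₘ × Xₙ)`, and applying `𝒮ⁿ⁺¹(σ)` shows that the chains
agree in `𝒮ⁿ⁺²(G × Xₙ₊₁)` (`toNaiveIter_eq`). The parameter presheaf `G` is carried along because
the unit `a` has to stay fixed: the induction replaces `G` by `G × 𝔾ₘ`. At the end `G` is a point,
and local surjectivity of `Xₙ ⟶ 𝒮ⁿ⁺¹(Xₙ)` gives a single section over every smooth scheme, hence a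
single value at every field. -/

noncomputable section

namespace NaiveA1

/-! ### Morphisms into a sheaf from locally defined values -/

section Gluing

universe v₁ u₁ w

variable {C : Type u₁} [Category.{v₁} C] {J : GrothendieckTopology C}

/-- A relation between the sections of a presheaf `P` and those of a sheaf `T` which is stable under
restriction, locally total and right-unique is the graph of a morphism. -/
lemma exists_hom_of_rel {P T : Cᵒᵖ ⥤ Type w} (hT : Presieve.IsSheaf J T)
    (R : ∀ U : C, P.obj (op U) → T.obj (op U) → Prop)
    (hmap : ∀ {U V : C} (f : V ⟶ U) (x : P.obj (op U)) (s : T.obj (op U)), R U x s →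
      R V (P.map f.op x) (T.map f.op s))
    (huniq : ∀ {U : C} (x : P.obj (op U)) (s t : T.obj (op U)), R U x s → R U x t → s = t)
    (hloc : ∀ {U : C} (x : P.obj (op U)),
      ∃ S ∈ J U, ∀ {V : C} (f : V ⟶ U), S f → ∃ s, R V (P.map f.op x) s) :
    ∃ σ : P ⟶ T, ∀ {U : C} (x : P.obj (op U)) (s : T.obj (op U)), R U x s →
      σ.app (op U) x = s := by
  -- The glued section is required to match every related value over every `V ⟶ U`, not only those
  -- used for gluing; naturality then needs no choice of cover to be compared.
  have key : ∀ (U : C) (x : P.obj (op U)), ∃ t : T.obj (op U), ∀ (V : C) (f : V ⟶ U)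
      (s : T.obj (op V)), R V (P.map f.op x) s → T.map f.op t = s := by
    intro U x
    obtain ⟨S, hS, hR⟩ := hloc x
    choose s hs using @hR
    let fam : Presieve.FamilyOfElements T S.arrows := fun V f hf => s f hf
    have hfam : fam.Compatible := by
      intro Y₁ Y₂ Z g₁ g₂ f₁ f₂ h₁ h₂ hg
      have e₁ := hmap g₁ _ _ (hs f₁ h₁)
      have e₂ := hmap g₂ _ _ (hs f₂ h₂)
      rw [← ConcreteCategory.comp_apply, ← P.map_comp, ← op_comp] at e₁ e₂
      rw [← hg] at e₂
      exact huniq _ _ _ e₁ e₂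
    obtain ⟨t, ht, -⟩ := hT S hS fam hfam
    refine ⟨t, fun V f s' hs' => ?_⟩
    refine (hT (S.pullback f) (J.pullback_stable f hS)).isSeparatedFor.ext fun W g hg => ?_
    have h₁ := ht (g ≫ f) hg
    rw [op_comp, T.map_comp, ConcreteCategory.comp_apply] at h₁
    rw [h₁]
    have h₂ := hmap g _ _ hs'
    rw [← ConcreteCategory.comp_apply, ← P.map_comp, ← op_comp] at h₂
    exact huniq _ _ _ (hs (g ≫ f) hg) h₂
  choose τ hτ using key
  refine ⟨{ app := fun U => TypeCat.ofHom (τ U.unop), naturality := ?_ }, ?_⟩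
  · rintro ⟨U⟩ ⟨V⟩ ⟨f : V ⟶ U⟩
    ext x
    change τ V (P.map f.op x) = T.map f.op (τ U x)
    obtain ⟨S, hS, hR⟩ := hloc (P.map f.op x)
    refine (hT S hS).isSeparatedFor.ext fun W g hg => ?_
    obtain ⟨s, hs⟩ := hR g hg
    rw [hτ V _ W g s hs, ← ConcreteCategory.comp_apply, ← T.map_comp, ← op_comp]
    refine (hτ U x W (g ≫ f) s ?_).symm
    rwa [op_comp, P.map_comp, ConcreteCategory.comp_apply]
  · intro U x s hs
    have := hτ U x U (𝟙 U) s (by simpa using hs)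
    simpa using this

end Gluing

/-! ### Functoriality of `𝒮` and of its iterates -/

section Functoriality

variable {K : Type u} [Field K]

/-- The map on naive `𝔸¹`-homotopy classes induced by a morphism of presheaves. -/
def naivePreMap {F G : (Sm K)ᵒᵖ ⥤ Type (u + 1)} (α : F ⟶ G) : naivePre F ⟶ naivePre G where
  app U := TypeCat.ofHom (Quot.map (α.app U) (by
    rintro _ _ ⟨h, rfl, rfl⟩
    exact ⟨α.app _ h, (NatTrans.naturality_apply α _ h).symm,
      (NatTrans.naturality_apply α _ h).symm⟩))
  naturality _ V f := by
    ext ⟨x⟩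
    change Quot.mk _ (α.app V (F.map f x)) = Quot.mk _ (G.map f (α.app _ x))
    rw [NatTrans.naturality_apply]

/-- The quotient map from a presheaf to its naive `𝔸¹`-homotopy classes. -/
def toNaivePre (F : (Sm K)ᵒᵖ ⥤ Type (u + 1)) : F ⟶ naivePre F where
  app U := TypeCat.ofHom (Quot.mk _)
  naturality _ _ _ := rfl

/-- The canonical morphism `F ⟶ 𝒮(F)`. -/
def toNaive (F : (Sm K)ᵒᵖ ⥤ Type (u + 1)) : F ⟶ naiveComponents F :=
  toNaivePre F ≫ toSheafify (nisnevich K) (naivePre F)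

/-- The morphism `𝒮(F) ⟶ 𝒮(G)` induced by `F ⟶ G`. -/
def naiveMap {F G : (Sm K)ᵒᵖ ⥤ Type (u + 1)} (α : F ⟶ G) :
    naiveComponents F ⟶ naiveComponents G :=
  sheafifyMap (nisnevich K) (naivePreMap α)

lemma toNaive_naturality {F G : (Sm K)ᵒᵖ ⥤ Type (u + 1)} (α : F ⟶ G) :
    toNaive F ≫ naiveMap α = α ≫ toNaive G := by
  have h : toNaivePre F ≫ naivePreMap α = α ≫ toNaivePre G := rfl
  refine (Category.assoc _ _ _).trans ?_
  refine (congrArg (toNaivePre F ≫ ·) (toSheafify_naturality _ (naivePreMap α)).symm).trans ?_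
  exact (Category.assoc _ _ _).symm.trans ((congrArg (· ≫ toSheafify _ _) h).trans
    (Category.assoc _ _ _))

lemma toNaive_eq_of_isHomotopic {F : (Sm K)ᵒᵖ ⥤ Type (u + 1)} {U : Sm K} {x y : F.obj (op U)}
    (h : IsHomotopic F U x y) : (toNaive F).app (op U) x = (toNaive F).app (op U) y :=
  congrArg ((toSheafify (nisnevich K) (naivePre F)).app (op U)) (Quot.sound h)

lemma isSheaf_naiveComponents (F : (Sm K)ᵒᵖ ⥤ Type (u + 1)) :
    Presieve.IsSheaf (nisnevich K) (naiveComponents F) :=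
  (isSheaf_iff_isSheaf_of_type _ _).1 (((presheafToSheaf (nisnevich K) (Type (u + 1))).obj (naivePre F)).property)

instance (F : (Sm K)ᵒᵖ ⥤ Type (u + 1)) :
    Presheaf.IsLocallySurjective (nisnevich K) (toNaive F) := by
  have : Presheaf.IsLocallySurjective (nisnevich K) (toNaivePre F) :=
    Presheaf.isLocallySurjective_of_surjective _ _ fun _ => Quot.mk_surjective
  have : Presheaf.IsLocallySurjective (nisnevich K) (toSheafify (nisnevich K) (naivePre F)) :=
    Presheaf.isLocallySurjective_toSheafify'.{u, u + 1} _ (naivePre F)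
  exact Presheaf.isLocallySurjective_comp _ (toNaivePre F) (toSheafify (nisnevich K) (naivePre F))

/-- The canonical morphism `F ⟶ 𝒮ⁿ(F)`. -/
def toNaiveIter : ∀ (n : ℕ) (F : (Sm K)ᵒᵖ ⥤ Type (u + 1)), F ⟶ naiveComponents^[n] F
  | 0, F => 𝟙 F
  | n + 1, F => toNaive F ≫ toNaiveIter n (naiveComponents F)

/-- The morphism `𝒮ⁿ(F) ⟶ 𝒮ⁿ(G)` induced by `F ⟶ G`. -/
def naiveIterMap : ∀ (n : ℕ) {F G : (Sm K)ᵒᵖ ⥤ Type (u + 1)}, (F ⟶ G) →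
    (naiveComponents^[n] F ⟶ naiveComponents^[n] G)
  | 0, _, _, α => α
  | n + 1, _, _, α => naiveIterMap n (naiveMap α)

lemma toNaiveIter_naturality (n : ℕ) {F G : (Sm K)ᵒᵖ ⥤ Type (u + 1)} (α : F ⟶ G) :
    toNaiveIter n F ≫ naiveIterMap n α = α ≫ toNaiveIter n G := by
  induction n generalizing F G with
  | zero => exact (Category.id_comp _).trans (Category.comp_id _).symm
  | succ n ih =>
    change (toNaive F ≫ toNaiveIter n _) ≫ naiveIterMap n (naiveMap α) =
      α ≫ toNaive G ≫ toNaiveIter n _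
    rw [Category.assoc, ih, ← Category.assoc, toNaive_naturality, Category.assoc]

lemma naiveIterMap_toNaiveIter_apply (n : ℕ) {F G : (Sm K)ᵒᵖ ⥤ Type (u + 1)} (α : F ⟶ G)
    {U : Sm K} (x : F.obj (op U)) :
    (naiveIterMap n α).app (op U) ((toNaiveIter n F).app (op U) x) =
      (toNaiveIter n G).app (op U) (α.app (op U) x) :=
  ConcreteCategory.congr_hom (congrArg (fun β => NatTrans.app β (op U))
    (toNaiveIter_naturality n α)) x

lemma isSheaf_naiveIter (n : ℕ) (F : (Sm K)ᵒᵖ ⥤ Type (u + 1)) :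
    Presieve.IsSheaf (nisnevich K) (naiveComponents^[n + 1] F) := by
  induction n generalizing F with
  | zero => exact isSheaf_naiveComponents F
  | succ n ih => exact ih (naiveComponents F)

/-- Passing to a quotient and sheafifying are both locally surjective. Sections of an iterate can
thus be compared by lifting them locally to sections of `F`. -/
instance isLocallySurjective_toNaiveIter (n : ℕ) (F : (Sm K)ᵒᵖ ⥤ Type (u + 1)) :
    Presheaf.IsLocallySurjective (nisnevich K) (toNaiveIter n F) := by
  induction n generalizing F with
  | zero => exact inferInstanceAs (Presheaf.IsLocallySurjective _ (𝟙 F))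
  | succ n ih =>
    have := ih (naiveComponents F)
    exact Presheaf.isLocallySurjective_comp _ (toNaive F) (toNaiveIter n (naiveComponents F))

end Functoriality

/-! ### Nisnevich neighbourhoods and invertible functions -/

section Neighbourhoods

variable {K : Type u} [Field K]

/-- The condition that `f : V ⟶ U` is étale and has a point above `u` with the same residue
field. -/
def IsNisnevichAt {V U : Sm K} (f : V ⟶ U) (u : U.left) : Prop :=
  Etale f.left ∧ ∃ v : V.left, f.left v = u ∧ Function.Bijective (f.left.residueFieldMap v)

/-- Sections of a Nisnevich sheaf which agree locally are equal. -/
lemma eq_of_locally_eq {T : (Sm K)ᵒᵖ ⥤ Type (u + 1)} (hT : Presieve.IsSheaf (nisnevich K) T)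
    {U : Sm K} (s t : T.obj (op U))
    (h : ∀ u : U.left, ∃ (V : Sm K) (f : V ⟶ U), T.map f.op s = T.map f.op t ∧
      IsNisnevichAt f u) : s = t := by
  let S : Sieve U :=
    { arrows := fun V f => T.map f.op s = T.map f.op t
      downward_closed := by
        intro V W f hf g
        rw [op_comp, T.map_comp, ConcreteCategory.comp_apply, ConcreteCategory.comp_apply, hf] }
  exact (hT S h).isSeparatedFor.ext fun _ _ hf => hf

/-- A quasi-compact étale `U`-scheme as an object of `Sm/K`. -/
def etaleSm {U : Sm K} {W : Scheme.{u}} (p : W ⟶ U.left) [Etale p] [QuasiCompact p] : Sm K :=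
  MorphismProperty.Over.mk ⊤ (p ≫ U.hom) (by
    have h1 : Smooth U.hom := U.prop.1
    have h2 : QuasiCompact U.hom := U.prop.2
    exact ⟨inferInstance, inferInstance⟩)

/-- The structure morphism of `etaleSm p`. -/
def etaleSmHom {U : Sm K} {W : Scheme.{u}} (p : W ⟶ U.left) [Etale p] [QuasiCompact p] :
    etaleSm p ⟶ U :=
  MorphismProperty.Over.homMk p rfl trivial

lemma isNisnevichAt_etaleSmHom {U : Sm K} {W : Scheme.{u}} (p : W ⟶ U.left) [Etale p]
    [QuasiCompact p] (u : U.left) (s : Spec (U.left.residueField u) ⟶ W)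
    (hs : s ≫ p = U.left.fromSpecResidueField u) : IsNisnevichAt (etaleSmHom p) u :=
  ⟨‹Etale p›, exists_point_of_lift p u s hs⟩

lemma isUnit_iff_Γevaluation_ne_zero {Y : Scheme.{u}} (a : Γ(Y, ⊤)) :
    IsUnit a ↔ ∀ y : Y, Y.Γevaluation y a ≠ 0 := by
  constructor
  · intro h y
    exact (h.map (Y.Γevaluation y).hom).ne_zero
  · intro h
    refine Y.toRingedSpace.isUnit_of_isUnit_germ ⊤ a fun y _ => ?_
    exact (Scheme.mem_basicOpen (U := ⊤) _ _ y trivial).1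
      ((Scheme.evaluation_ne_zero_iff_mem_basicOpen (U := ⊤) _ y trivial a).1 (h y))

/-- Makes inclusions of open subschemes quasi-compact, so that a basic open is again an object of
`Sm K`. -/
lemma isLocallyNoetherian_left (U : Sm K) : IsLocallyNoetherian U.left := by
  have : Smooth U.hom := U.prop.1
  have : IsLocallyNoetherian ((Functor.fromPUnit (Spec (CommRingCat.of K))).obj U.right) :=
    inferInstanceAs (IsLocallyNoetherian (Spec (CommRingCat.of K)))
  exact LocallyOfFiniteType.isLocallyNoetherian U.hom

lemma isUnit_appTop_iff {X Y : Scheme.{u}} (f : X ⟶ Y) (a : Γ(Y, ⊤)) :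
    IsUnit (f.appTop a) ↔ ∀ x : X, Y.Γevaluation (f x) a ≠ 0 := by
  refine (isUnit_iff_Γevaluation_ne_zero _).trans (forall_congr' fun x => ?_)
  rw [← Scheme.Γevaluation_naturality_apply, map_ne_zero]

/-- Restriction of functions along a morphism of smooth schemes. -/
def res {V U : Sm K} (f : V ⟶ U) : Γ(U.left, ⊤) →+* Γ(V.left, ⊤) := f.left.appTop.hom

/-- Around a point at which a function does not vanish, the function becomes invertible. -/
lemma exists_isUnit_res {U : Sm K} (u : U.left) (a : Γ(U.left, ⊤))
    (ha : U.left.Γevaluation u a ≠ 0) :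
    ∃ (V : Sm K) (f : V ⟶ U), IsUnit (res f a) ∧ IsNisnevichAt f u := by
  have := isLocallyNoetherian_left U
  have hu : u ∈ U.left.basicOpen a := (Scheme.evaluation_ne_zero_iff_mem_basicOpen _ u _ a).1 ha
  have hr : Set.range (U.left.fromSpecResidueField u) ⊆ Set.range (U.left.basicOpen a).ι := by
    rw [Scheme.range_fromSpecResidueField, Scheme.Opens.range_ι]
    simpa using hu
  refine ⟨etaleSm (U.left.basicOpen a).ι, etaleSmHom (U.left.basicOpen a).ι, ?_,
    isNisnevichAt_etaleSmHom _ u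
      (IsOpenImmersion.lift (U.left.basicOpen a).ι (U.left.fromSpecResidueField u) hr)
      (IsOpenImmersion.lift_fac _ _ _)⟩
  exact (isUnit_appTop_iff (U.left.basicOpen a).ι a).2 fun y =>
    (Scheme.evaluation_ne_zero_iff_mem_basicOpen (U := ⊤) _ _ trivial a).2 y.2

end Neighbourhoods

/-! ### Étale-local square roots with a prescribed value -/

section SquareRoots

variable {K : Type u} [Field K]

open Polynomial in
/-- The standard étale algebra `A[w]/(w² - b)`, localized at `w (w + k)`. -/
def sqrtPair {A : Type u} [CommRing A] (h2 : IsUnit (2 : A)) (b k : A) :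
    StandardEtalePair A where
  f := Polynomial.X ^ 2 - C b
  monic_f := monic_X_pow_sub_C b two_ne_zero
  g := Polynomial.X * (Polynomial.X + C k)
  cond := by
    obtain ⟨t, ht⟩ := h2.exists_left_inv
    -- With `t = 1/2`, multiplying the derivative `2X` by `t (X + k)` gives exactly `X (X + k)`.
    refine ⟨C t * (Polynomial.X + C k), 0, 1, ?_⟩
    have ht' : C t * (2 : A[X]) = 1 := by rw [← C_ofNat, ← C_mul, ht, C_1]
    simp only [derivative_sub, derivative_X_pow, derivative_C, Nat.cast_ofNat, map_ofNat]
    linear_combination Polynomial.X * (Polynomial.X + C k) * ht'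

lemma sqrtPair_hasMap_iff {A B : Type u} [CommRing A] [CommRing B] [Algebra A B]
    (h2 : IsUnit (2 : A)) (b k : A) (w : B) :
    (sqrtPair h2 b k).HasMap w ↔
      w ^ 2 = algebraMap A B b ∧ IsUnit w ∧ IsUnit (w + algebraMap A B k) := by
  simp [StandardEtalePair.HasMap, sqrtPair, sub_eq_zero]

/-- A Nisnevich neighbourhood on which `b` has a square root `w` for which `w + k` is invertible,
around a point where the value of `b` has such a root. -/
lemma exists_sqrt_res {U : Sm K} (u : U.left) (h2 : IsUnit (2 : Γ(U.left, ⊤)))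
    (b k : Γ(U.left, ⊤)) (z : U.left.residueField u) (hz : z ^ 2 = U.left.Γevaluation u b)
    (hz0 : z ≠ 0) (hzk : z + U.left.Γevaluation u k ≠ 0) :
    ∃ (V : Sm K) (f : V ⟶ U), (∃ w : Γ(V.left, ⊤), w ^ 2 = res f b ∧ IsUnit (w + res f k)) ∧
      IsNisnevichAt f u := by
  let P := sqrtPair h2 b k
  let p : Spec (CommRingCat.of P.Ring) ⟶ Spec Γ(U.left, ⊤) :=
    Spec.map (CommRingCat.ofHom (algebraMap Γ(U.left, ⊤) P.Ring))
  have : Etale p := by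
    rw [HasRingHomProperty.Spec_iff (P := @Etale)]
    exact RingHom.etale_algebraMap.2 (inferInstanceAs (Algebra.Etale _ P.Ring))
  let _ : Algebra Γ(U.left, ⊤) (U.left.residueField u) := (U.left.Γevaluation u).hom.toAlgebra
  have hP : P.HasMap z := (sqrtPair_hasMap_iff _ _ _ _).2 ⟨hz, hz0.isUnit, hzk.isUnit⟩
  -- The root `z` in the residue field is a rational point of the étale algebra above `u`. As `U`
  -- need not be affine, the algebra is then pulled back along `U ⟶ Spec Γ(U)`.
  let t : Spec (U.left.residueField u) ⟶ Spec (CommRingCat.of P.Ring) :=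
    Spec.map (CommRingCat.ofHom (P.lift z hP).toRingHom)
  have ht : U.left.fromSpecResidueField u ≫ U.left.toSpecΓ = t ≫ p := by
    rw [Scheme.fromSpecResidueField, Category.assoc, Scheme.fromSpecStalk_toSpecΓ,
      ← Spec.map_comp]
    refine Eq.trans ?_ (Spec.map_comp _ _)
    congr 1
    ext a
    exact ((P.lift z hP).commutes a).symm
  let q := pullback.fst U.left.toSpecΓ p
  let r := pullback.snd U.left.toSpecΓ p
  let ψ : P.Ring →+* Γ(pullback U.left.toSpecΓ p, ⊤) :=
    ((Scheme.ΓSpecIso (CommRingCat.of P.Ring)).inv ≫ r.appTop).hom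
  have hψ : ψ.comp (algebraMap _ _) = q.appTop.hom := by
    have h := congrArg Scheme.Hom.appTop (pullback.condition (f := U.left.toSpecΓ) (g := p))
    rw [Scheme.Hom.comp_appTop, Scheme.Hom.comp_appTop, Scheme.toSpecΓ_appTop,
      ← Iso.eq_inv_comp, ← Category.assoc, ← Scheme.ΓSpecIso_inv_naturality] at h
    exact congrArg CommRingCat.Hom.hom h.symm
  let _ : Algebra Γ(U.left, ⊤) Γ(pullback U.left.toSpecΓ p, ⊤) := q.appTop.hom.toAlgebra
  let ψ' : P.Ring →ₐ[Γ(U.left, ⊤)] Γ(pullback U.left.toSpecΓ p, ⊤) :=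
    { ψ with commutes' := fun a => RingHom.congr_fun hψ a }
  obtain ⟨h₁, -, h₂⟩ := (sqrtPair_hasMap_iff h2 b k _).1 (P.hasMap_X.map ψ')
  exact ⟨etaleSm q, etaleSmHom q, ⟨ψ' P.X, h₁, h₂⟩, isNisnevichAt_etaleSmHom q u
    (pullback.lift _ _ ht) (pullback.lift_fst _ _ _)⟩

end SquareRoots

/-! ### Coordinates of points of `Xₙ` -/

section Chains

/-- Pullback of global functions along a morphism of `ℂ`-schemes. -/
def pull {T T' : Over base} (f : T' ⟶ T) : Γ(T.left, ⊤) →+* Γ(T'.left, ⊤) := f.left.appTop.hom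

lemma pull_id (T : Over base) (a : Γ(T.left, ⊤)) : pull (𝟙 T) a = a := by
  change (𝟙 T.left : T.left ⟶ T.left).appTop a = a
  simp

lemma pull_comp {T T' T'' : Over base} (g : T'' ⟶ T') (f : T' ⟶ T) (a : Γ(T.left, ⊤)) :
    pull (g ≫ f) a = pull g (pull f a) := by
  change (g.left ≫ f.left).appTop a = _
  rw [Scheme.Hom.comp_appTop]
  rfl

/-- Evaluation of a function at a point. -/
def ev {T : Over base} (t : T.left) : Γ(T.left, ⊤) →+* T.left.residueField t :=
  (T.left.Γevaluation t).hom

lemma ev_pull_eq_zero_iff {T T' : Over base} (f : T' ⟶ T) (t : T'.left) (a : Γ(T.left, ⊤)) :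
    ev t (pull f a) = 0 ↔ ev (f.left t) a = 0 := by
  have h := Scheme.Γevaluation_naturality_apply f.left t a
  refine Iff.trans (Eq.congr_left h.symm) ?_
  exact map_eq_zero (f.left.residueFieldMap t).hom

lemma isUnit_iff_ev_ne_zero {T : Over base} (a : Γ(T.left, ⊤)) :
    IsUnit a ↔ ∀ t : T.left, ev t a ≠ 0 :=
  isUnit_iff_Γevaluation_ne_zero a

/-- The constant functions on a `ℂ`-scheme. -/
def const (T : Over base) : ℂ →+* Γ(T.left, ⊤) :=
  ((Scheme.ΓSpecIso (CommRingCat.of ℂ)).inv ≫ T.hom.appTop).hom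

lemma pull_const {T T' : Over base} (f : T' ⟶ T) (c : ℂ) : pull f (const T c) = const T' c := by
  change (T.hom.appTop ≫ f.left.appTop) ((Scheme.ΓSpecIso (CommRingCat.of ℂ)).inv c) = _
  rw [← Scheme.Hom.comp_appTop, Over.w f]
  rfl

variable (l : Fin 3 → ℂ)

/-- The value at a function `a` of the polynomial `(x - λ₁) (x - λ₂) (x - λ₃)`. -/
def cubic {T : Over base} (a : Γ(T.left, ⊤)) : Γ(T.left, ⊤) := ∏ j, (a - const T (l j))

lemma pull_cubic {T T' : Over base} (f : T' ⟶ T) (a : Γ(T.left, ⊤)) :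
    pull f (cubic l a) = cubic l (pull f a) := by
  simp [cubic, map_prod, pull_const]

/-- The coordinates `(x₀, …, xₙ, y₁, …, yₙ)` of a `T`-valued point of `Xₙ`. -/
@[ext]
structure Chain (n : ℕ) (T : Over base) where
  /-- The coordinates `x₀, …, xₙ`. -/
  x : Fin (n + 1) → Γ(T.left, ⊤)
  /-- The coordinates `y₁, …, yₙ`. -/
  y : Fin n → Γ(T.left, ⊤)
  eq : ∀ i : Fin n, y i ^ 2 = x i.castSucc ^ 2 * cubic l (x i.succ)
  ne_zero : ∀ (i : Fin n) (t : T.left), ev t (x i.castSucc) ≠ 0 ∨ ev t (x i.succ) ≠ 0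

variable {l}

namespace Chain

variable {n : ℕ} {T T' T'' : Over base}

/-- Pullback of chains of coordinates. -/
@[simps]
def map (f : T' ⟶ T) (p : Chain l n T) : Chain l n T' where
  x i := pull f (p.x i)
  y i := pull f (p.y i)
  eq i := by rw [← map_pow, p.eq, map_mul, map_pow, pull_cubic]
  ne_zero i t := by
    simp only [ne_eq, ev_pull_eq_zero_iff]
    exact p.ne_zero i _

lemma map_id (p : Chain l n T) : p.map (𝟙 T) = p := by
  ext <;> simp [pull_id]

lemma map_comp (g : T'' ⟶ T') (f : T' ⟶ T) (p : Chain l n T) :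
    p.map (g ≫ f) = (p.map f).map g := by
  ext <;> simp [pull_comp]

/-- Omit the last `x` and the last `y`. -/
@[simps]
def init (p : Chain l (n + 1) T) : Chain l n T where
  x i := p.x i.castSucc
  y i := p.y i.castSucc
  eq i := p.eq i.castSucc
  ne_zero i t := p.ne_zero i.castSucc t

/-- Omit the first `x` and the first `y`. -/
@[simps]
def tail (p : Chain l (n + 1) T) : Chain l n T where
  x i := p.x i.succ
  y i := p.y i.succ
  eq i := p.eq i.succ
  ne_zero i t := p.ne_zero i.succ t

/-- Put one more `x` and one more `y` in front. -/
@[simps]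
def cons (p : Chain l n T) (a b : Γ(T.left, ⊤)) (h : b ^ 2 = a ^ 2 * cubic l (p.x 0))
    (h0 : ∀ t : T.left, ev t a ≠ 0 ∨ ev t (p.x 0) ≠ 0) : Chain l (n + 1) T where
  x := Fin.cons a p.x
  y := Fin.cons b p.y
  eq i := by
    cases i using Fin.cases with
    | zero => simpa using h
    | succ i => simpa [← Fin.succ_castSucc] using p.eq i
  ne_zero i t := by
    cases i using Fin.cases with
    | zero => simpa using h0 t
    | succ i => simpa [← Fin.succ_castSucc] using p.ne_zero i t

lemma tail_cons (p : Chain l n T) (a b : Γ(T.left, ⊤)) (h) (h0) :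
    (p.cons a b h h0).tail = p := by
  ext <;> simp

lemma ext_cons {p q : Chain l (n + 1) T} (hx : p.x 0 = q.x 0) (hy : p.y 0 = q.y 0)
    (ht : p.tail = q.tail) : p = q := by
  apply Chain.ext
  · funext i
    cases i using Fin.cases with
    | zero => exact hx
    | succ i => exact congrFun (congrArg Chain.x ht) i
  · funext i
    cases i using Fin.cases with
    | zero => exact hy
    | succ i => exact congrFun (congrArg Chain.y ht) i

lemma eq_of_init_eq_of_tail_eq {p q : Chain l (n + 2) T} (hi : p.init = q.init)
    (ht : p.tail = q.tail) : p = q :=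
  ext_cons (congrFun (congrArg Chain.x hi) 0) (congrFun (congrArg Chain.y hi) 0) ht

/-- Two chains overlapping in all but one step concatenate; this is the fibre product defining the
next stage. -/
lemma exists_init_eq_tail_eq {p q : Chain l (n + 1) T} (h : p.tail = q.init) :
    ∃ r : Chain l (n + 2) T, r.init = p ∧ r.tail = q := by
  have hx : q.x 0 = p.x 1 := (congrFun (congrArg Chain.x h) 0).symm
  refine ⟨q.cons (p.x 0) (p.y 0) (by rw [hx]; exact p.eq 0)
    (fun t => by rw [hx]; exact p.ne_zero 0 t), ?_, tail_cons _ _ _ _ _⟩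
  refine ext_cons rfl rfl ?_
  rw [h]
  rfl

end Chain

/-! ### Points of `X₀` and `X₁` in coordinates -/

/-- The coordinate of a point of the affine line. -/
def coordOf {T : Over base} (z : T ⟶ X₀) : Γ(T.left, ⊤) :=
  z.left.appTop (AffineSpace.coord base PUnit.unit)

lemma coordOf_comp {T T' : Over base} (f : T' ⟶ T) (z : T ⟶ X₀) :
    coordOf (f ≫ z) = pull f (coordOf z) := by
  change (f.left ≫ z.left).appTop _ = _
  rw [Scheme.Hom.comp_appTop]
  rfl

lemma coordOf_injective {T : Over base} : Function.Injective (coordOf (T := T)) := by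
  intro z z' h
  apply Over.OverMorphism.ext
  refine AffineSpace.hom_ext ?_ fun _ => h
  exact (Over.w z).trans (Over.w z').symm

lemma coordOf_surjective {T : Over base} : Function.Surjective (coordOf (T := T)) := fun a =>
  ⟨Over.homMk (AffineSpace.homOfVector T.hom fun _ => a) (AffineSpace.homOfVector_over _ _),
    AffineSpace.homOfVector_appTop_coord _ _ _⟩

/-- The map on coordinate rings induced by a point of `X₁`. -/
def surfaceHom {T : Over base} (z : T ⟶ X₁ l) : SurfaceRing l →+* Γ(T.left, ⊤) :=
  ((Scheme.ΓSpecIso (CommRingCat.of (SurfaceRing l))).inv ≫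
    (z.left ≫ (puncturedOpens l).ι).appTop).hom

lemma surfaceHom_coord {T : Over base} (z : T ⟶ X₁ l) (i : Fin 3) :
    surfaceHom z (surfaceCoord l i) = coordOf (z ≫ coordMap l i) := by
  change _ = ((z.left ≫ (puncturedOpens l).ι) ≫ Y₁ToLine l i).appTop _
  rw [Scheme.Hom.comp_appTop, ConcreteCategory.comp_apply]
  have : (Y₁ToLine l i).appTop (AffineSpace.coord base PUnit.unit) =
      (Scheme.ΓSpecIso (CommRingCat.of (SurfaceRing l))).inv (surfaceCoord l i) :=
    AffineSpace.homOfVector_appTop_coord _ _ _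
  rw [this]
  rfl

lemma surfaceHom_algebraMap {T : Over base} (z : T ⟶ X₁ l) (c : ℂ) :
    surfaceHom z (algebraMap ℂ _ c) = const T c := by
  have h : (z.left ≫ (puncturedOpens l).ι) ≫ Y₁ToBase l = T.hom :=
    (Category.assoc _ _ _).trans (Over.w z)
  change _ = T.hom.appTop _
  rw [← h, Scheme.Hom.comp_appTop, ConcreteCategory.comp_apply]
  have := ConcreteCategory.congr_hom (Scheme.ΓSpecIso_inv_naturality
    (CommRingCat.ofHom (algebraMap ℂ (SurfaceRing l)))) c
  exact congrArg (z.left ≫ (puncturedOpens l).ι).appTop this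

lemma surfaceHom_ext {A : Type*} [CommRing A] {f g : SurfaceRing l →+* A}
    (hC : ∀ c, f (algebraMap ℂ _ c) = g (algebraMap ℂ _ c))
    (hX : ∀ i, f (surfaceCoord l i) = g (surfaceCoord l i)) : f = g := by
  refine Ideal.Quotient.ringHom_ext (MvPolynomial.ringHom_ext hC hX)

/-- The open immersion into `Y₁` is a monomorphism, and maps to an affine scheme are determined on
coordinates. -/
lemma hom_X₁_ext {T : Over base} {z z' : T ⟶ X₁ l}
    (h : ∀ i, coordOf (z ≫ coordMap l i) = coordOf (z' ≫ coordMap l i)) : z = z' := by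
  apply Over.OverMorphism.ext
  refine (cancel_mono (puncturedOpens l).ι).1 (ext_to_Spec ?_)
  refine CommRingCat.hom_ext (surfaceHom_ext (f := surfaceHom z) (g := surfaceHom z') ?_ ?_)
  · intro c
    rw [surfaceHom_algebraMap, surfaceHom_algebraMap]
  · intro i
    rw [surfaceHom_coord, surfaceHom_coord, h]

lemma surfaceCoord_rel :
    surfaceCoord l 2 ^ 2 = surfaceCoord l 0 ^ 2 *
      ∏ j, (surfaceCoord l 1 - algebraMap ℂ (SurfaceRing l) (l j)) := by
  have h : Ideal.Quotient.mk (Ideal.span {surfacePoly l}) (surfacePoly l) = 0 :=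
    Ideal.Quotient.eq_zero_iff_mem.2 (Ideal.mem_span_singleton_self _)
  rw [surfacePoly, map_sub, map_mul, map_prod, sub_eq_zero, map_pow, map_pow] at h
  exact h

lemma coordOf_rel {T : Over base} (z : T ⟶ X₁ l) :
    coordOf (z ≫ coordMap l 2) ^ 2 =
      coordOf (z ≫ coordMap l 0) ^ 2 * cubic l (coordOf (z ≫ coordMap l 1)) := by
  have h := congrArg (surfaceHom z) (surfaceCoord_rel (l := l))
  simpa only [map_mul, map_pow, map_prod, map_sub, surfaceHom_coord, surfaceHom_algebraMap,
    cubic] using h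

lemma ev_appTop_eq_zero_iff {T : Over base} {A : CommRingCat} (f : T.left ⟶ Spec A) (t : T.left)
    (a : A) : ev t (f.appTop ((Scheme.ΓSpecIso A).inv a)) = 0 ↔ a ∈ (f t).asIdeal := by
  have h : ev t (f.appTop ((Scheme.ΓSpecIso A).inv a)) = 0 ↔
      (Spec A).Γevaluation (f t) ((Scheme.ΓSpecIso A).inv a) = 0 := by
    refine Iff.trans (Eq.congr_left (Scheme.Γevaluation_naturality_apply f t _).symm) ?_
    exact map_eq_zero (f.residueFieldMap t).hom
  refine h.trans ((Scheme.evaluation_eq_zero_iff_notMem_basicOpen (U := ⊤) _ _ trivial _).trans ?_)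
  rw [basicOpen_eq_of_affine]
  exact not_not

lemma mem_puncturedOpens_iff {T : Over base} (f : T.left ⟶ Y₁ l) (t : T.left) :
    f t ∈ puncturedOpens l ↔ ∃ i, ev t (f.appTop
      ((Scheme.ΓSpecIso (CommRingCat.of (SurfaceRing l))).inv (surfaceCoord l i))) ≠ 0 := by
  have h : f t ∈ puncturedOpens l ↔ ∃ i, surfaceCoord l i ∉ (f t).asIdeal := by
    change ¬ (Set.range (surfaceCoord l) ⊆ _) ↔ _
    rw [Set.range_subset_iff, not_forall]
    rfl
  exact h.trans (exists_congr fun i => not_congr (ev_appTop_eq_zero_iff f t _).symm)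

/-- Where `x₀` vanishes, the equation forces `y₁` to vanish too, so avoiding the origin is a
condition on `x₀` and `x₁` alone. -/
lemma ev_coordOf_ne_zero {T : Over base} (z : T ⟶ X₁ l) (t : T.left) :
    ev t (coordOf (z ≫ coordMap l 0)) ≠ 0 ∨ ev t (coordOf (z ≫ coordMap l 1)) ≠ 0 := by
  obtain ⟨i, hi⟩ := (mem_puncturedOpens_iff (z.left ≫ (puncturedOpens l).ι) t).1 (z.left t).2
  replace hi : ev t (surfaceHom z (surfaceCoord l i)) ≠ 0 := hi
  rw [surfaceHom_coord] at hi
  fin_cases i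
  · exact Or.inl hi
  · exact Or.inr hi
  · refine Or.inl fun h => hi ?_
    have := congrArg (ev t) (coordOf_rel z)
    rw [map_mul, map_pow, map_pow, h] at this
    simpa using this

lemma exists_hom_Y₁ {T : Over base} (a : Fin 3 → Γ(T.left, ⊤))
    (h : a 2 ^ 2 = a 0 ^ 2 * cubic l (a 1)) :
    ∃ f : T.left ⟶ Y₁ l, f ≫ Y₁ToBase l = T.hom ∧ ∀ i, f.appTop
      ((Scheme.ΓSpecIso (CommRingCat.of (SurfaceRing l))).inv (surfaceCoord l i)) = a i := by
  let ρ : SurfaceRing l →+* Γ(T.left, ⊤) :=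
    Ideal.Quotient.lift _ (MvPolynomial.eval₂Hom (const T) a) (by
      intro b hb
      obtain ⟨d, rfl⟩ := Ideal.mem_span_singleton'.1 hb
      rw [map_mul, surfacePoly]
      simp only [map_sub, map_mul, map_pow, map_prod, MvPolynomial.eval₂Hom_X',
        MvPolynomial.eval₂Hom_C, h, cubic]
      ring)
  have hρC (c : ℂ) : ρ (algebraMap ℂ _ c) = const T c :=
    MvPolynomial.eval₂Hom_C (const T) a c
  have hρX (i : Fin 3) : ρ (surfaceCoord l i) = a i :=
    MvPolynomial.eval₂Hom_X' (const T) a i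
  let f : T.left ⟶ Y₁ l := T.left.toSpecΓ ≫ Spec.map (CommRingCat.ofHom ρ)
  have hf (r : SurfaceRing l) :
      f.appTop ((Scheme.ΓSpecIso (CommRingCat.of (SurfaceRing l))).inv r) = ρ r := by
    have h₁ : (Scheme.ΓSpecIso (CommRingCat.of (SurfaceRing l))).inv ≫ f.appTop =
        CommRingCat.ofHom ρ := by
      rw [Scheme.Hom.comp_appTop, Scheme.toSpecΓ_appTop, ← Category.assoc,
        ← Scheme.ΓSpecIso_inv_naturality, Category.assoc, Iso.inv_hom_id]
      exact Category.comp_id _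
    exact ConcreteCategory.congr_hom h₁ r
  refine ⟨f, ?_, fun i => (hf _).trans (hρX i)⟩
  · refine ext_to_Spec (CommRingCat.hom_ext (RingHom.ext fun c => ?_))
    refine Eq.trans ?_ (hρC c)
    rw [← hf]
    have := ConcreteCategory.congr_hom (Scheme.ΓSpecIso_inv_naturality
      (CommRingCat.ofHom (algebraMap ℂ (SurfaceRing l)))) c
    exact congrArg f.appTop this.symm

lemma exists_hom_X₁ {T : Over base} (a : Fin 3 → Γ(T.left, ⊤))
    (h : a 2 ^ 2 = a 0 ^ 2 * cubic l (a 1))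
    (h0 : ∀ t : T.left, ev t (a 0) ≠ 0 ∨ ev t (a 1) ≠ 0) :
    ∃ z : T ⟶ X₁ l, ∀ i, coordOf (z ≫ coordMap l i) = a i := by
  obtain ⟨f, hfT, hf⟩ := exists_hom_Y₁ a h
  have hmem (t : T.left) : f t ∈ puncturedOpens l := by
    rw [mem_puncturedOpens_iff]
    rcases h0 t with h0 | h0
    · exact ⟨0, by rwa [hf]⟩
    · exact ⟨1, by rwa [hf]⟩
  have hrange : Set.range f ⊆ Set.range (puncturedOpens l).ι := by
    rw [Scheme.Opens.range_ι]
    rintro _ ⟨t, rfl⟩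
    exact hmem t
  let g : T.left ⟶ (puncturedOpens l).toScheme :=
    IsOpenImmersion.lift (puncturedOpens l).ι f hrange
  have hg : g ≫ (puncturedOpens l).ι = f := IsOpenImmersion.lift_fac _ _ _
  let z : T ⟶ X₁ l := Over.homMk g
    ((Category.assoc _ _ _).symm.trans ((congrArg (· ≫ Y₁ToBase l) hg).trans hfT))
  refine ⟨z, fun i => ?_⟩
  rw [← surfaceHom_coord, ← hf]
  change (g ≫ (puncturedOpens l).ι).appTop _ = _
  rw [hg]
  rfl

/-- `T`-valued points of `Xₙ` are chains of coordinates, compatibly with `φₙ₊₁` and `ψₙ₊₁`. -/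
lemma exists_chain_bijection (l : Fin 3 → ℂ) (n : ℕ) :
    ∃ (α : ∀ T, Chain l n T → (T ⟶ (stage l n).tgt))
      (β : ∀ T, Chain l (n + 1) T → (T ⟶ (stage l n).src)),
      (∀ T, Function.Bijective (α T)) ∧ (∀ T, Function.Bijective (β T)) ∧
      (∀ {T T' : Over base} (f : T' ⟶ T) p, α T' (p.map f) = f ≫ α T p) ∧
      (∀ {T T' : Over base} (f : T' ⟶ T) p, β T' (p.map f) = f ≫ β T p) ∧
      (∀ T p, β T p ≫ (stage l n).φ = α T p.init) ∧
      (∀ T p, β T p ≫ (stage l n).ψ = α T p.tail) := by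
  induction n with
  | zero =>
    choose α hα using fun (T : Over base) (p : Chain l 0 T) => coordOf_surjective (p.x 0)
    choose β hβ using fun (T : Over base) (p : Chain l 1 T) =>
      exists_hom_X₁ (l := l) ![p.x 0, p.x 1, p.y 0] (p.eq 0) (p.ne_zero 0)
    refine ⟨α, β, fun T => ⟨fun p q h => ?_, fun z => ?_⟩, fun T => ⟨fun p q h => ?_, fun z => ?_⟩,
      fun f p => ?_, fun f p => ?_, fun T p => ?_, fun T p => ?_⟩
    · have := congrArg coordOf h
      rw [hα, hα] at this
      refine Chain.ext (funext fun i => ?_) (funext fun i => i.elim0)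
      obtain rfl : i = 0 := Subsingleton.elim (α := Fin 1) i 0
      exact this
    · refine ⟨⟨fun _ => coordOf z, Fin.elim0, fun i => i.elim0, fun i => i.elim0⟩,
        coordOf_injective ?_⟩
      rw [hα]
    · have key (i : Fin 3) := (hβ T p i).symm.trans ((congrArg (fun z => coordOf (z ≫ _)) h).trans
        (hβ T q i))
      refine Chain.ext_cons (key 0) (key 2) (Chain.ext (funext fun i => ?_)
        (funext fun i => i.elim0))
      obtain rfl : i = 0 := Subsingleton.elim (α := Fin 1) i 0
      exact key 1
    · refine ⟨⟨![coordOf (z ≫ coordMap l 0), coordOf (z ≫ coordMap l 1)],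
        ![coordOf (z ≫ coordMap l 2)], fun i => ?_, fun i t => ?_⟩, hom_X₁_ext fun i => ?_⟩
      · obtain rfl : i = 0 := Subsingleton.elim (α := Fin 1) i 0
        exact coordOf_rel z
      · obtain rfl : i = 0 := Subsingleton.elim (α := Fin 1) i 0
        exact ev_coordOf_ne_zero z t
      · rw [hβ]
        fin_cases i <;> rfl
    · exact coordOf_injective ((hα _ _).trans ((congrArg (pull f) (hα _ p)).symm.trans
        (coordOf_comp f (α _ p)).symm))
    · refine hom_X₁_ext fun i => ?_
      refine Eq.trans ?_ (congrArg coordOf (Category.assoc f (β _ p) (coordMap l i))).symm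
      refine (hβ _ _ i).trans (Eq.trans ?_ (coordOf_comp f (β _ p ≫ coordMap l i)).symm)
      rw [hβ]
      fin_cases i <;> rfl
    · apply coordOf_injective
      rw [hα]
      exact hβ T p 0
    · apply coordOf_injective
      rw [hα]
      exact hβ T p 1
  | succ n ih =>
    obtain ⟨α, β, hα, hβ, hαn, hβn, hφ, hψ⟩ := ih
    have hc (T : Over base) (p : Chain l (n + 2) T) :
        β T p.init ≫ (stage l n).ψ = β T p.tail ≫ (stage l n).φ := by
      rw [hφ, hψ]
      rfl
    -- The target of the new stage is the source of the old one, so the old `β` serves as the new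
    -- `α`.
    refine ⟨β, fun T p => pullback.lift (β T p.init) (β T p.tail) (hc T p), hβ, fun T => ⟨?_, ?_⟩,
      hβn, ?_, fun T p => pullback.lift_fst _ _ _, fun T p => pullback.lift_snd _ _ _⟩
    · intro p q h
      have h₁ := congrArg (· ≫ pullback.fst _ _) h
      have h₂ := congrArg (· ≫ pullback.snd _ _) h
      simp only [pullback.lift_fst, pullback.lift_snd] at h₁ h₂
      exact Chain.eq_of_init_eq_of_tail_eq ((hβ T).1 h₁) ((hβ T).1 h₂)
    · intro z
      change T ⟶ pullback (stage l n).ψ (stage l n).φ at z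
      obtain ⟨p, hp⟩ := (hβ T).2 (z ≫ pullback.fst _ _)
      obtain ⟨q, hq⟩ := (hβ T).2 (z ≫ pullback.snd _ _)
      have h : p.tail = q.init := by
        apply (hα T).1
        rw [← hφ, ← hψ, hp, hq, Category.assoc, Category.assoc, pullback.condition]
      obtain ⟨r, rfl, rfl⟩ := Chain.exists_init_eq_tail_eq h
      exact ⟨r, pullback.hom_ext ((pullback.lift_fst _ _ _).trans hp)
        ((pullback.lift_snd _ _ _).trans hq)⟩
    · intro T T' f p
      apply pullback.hom_ext
      · rw [pullback.lift_fst]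
        refine (hβn f p.init).trans ?_
        exact (congrArg (f ≫ ·) (pullback.lift_fst _ _ _).symm).trans (Category.assoc _ _ _).symm
      · rw [pullback.lift_snd]
        refine (hβn f p.tail).trans ?_
        exact (congrArg (f ≫ ·) (pullback.lift_snd _ _ _).symm).trans (Category.assoc _ _ _).symm

end Chains

/-! ### Local units and roots over `ℂ`, and the projection of `𝔸¹ × U` -/

section Connectedness

/-- A smooth `ℂ`-scheme as an object over the base. -/
abbrev ov (U : Sm ℂ) : Over base := (Sm.incl ℂ).obj U

/-- A morphism of smooth `ℂ`-schemes as a morphism over the base. -/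
abbrev ovMap {U V : Sm ℂ} (f : V ⟶ U) : ov V ⟶ ov U := (Sm.incl ℂ).map f

lemma ovMap_id (U : Sm ℂ) : ovMap (𝟙 U) = 𝟙 (ov U) := (Sm.incl ℂ).map_id U

lemma ovMap_comp {U V W : Sm ℂ} (g : W ⟶ V) (f : V ⟶ U) :
    ovMap (g ≫ f) = ovMap g ≫ ovMap f := (Sm.incl ℂ).map_comp g f

lemma exists_isUnit_pull {U : Sm ℂ} (u : (ov U).left) (a : Γ((ov U).left, ⊤)) (ha : ev u a ≠ 0) :
    ∃ (V : Sm ℂ) (f : V ⟶ U), IsUnit (pull (ovMap f) a) ∧ IsNisnevichAt f u :=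
  exists_isUnit_res (U := U) u a ha

variable {l : Fin 3 → ℂ}

lemma ev_cubic {T : Over base} {t : T.left} {a : Γ(T.left, ⊤)} (ha : ev t a = 0) :
    ev t (cubic l a) = ev t (const T (∏ j, -l j)) := by
  simp [cubic, map_prod, ha]

lemma ev_const_ne_zero {T : Over base} (t : T.left) {c : ℂ} (hc : c ≠ 0) :
    ev t (const T c) ≠ 0 :=
  (hc.isUnit.map ((ev t).comp (const T))).ne_zero

/-- At a zero of `a` the cubic takes the value `f(0) = c²`, so `c` is a root in the residue field.
Invertibility of `w + c` excludes the branch with value `-c` at zeros of `a`. -/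
lemma exists_sqrt_pull {c : ℂ} (hc0 : c ≠ 0) (hc : c ^ 2 = ∏ j, -l j) {U : Sm ℂ}
    (u : (ov U).left) (a : Γ((ov U).left, ⊤)) (ha : ev u a = 0) :
    ∃ (V : Sm ℂ) (f : V ⟶ U), (∃ w : Γ((ov V).left, ⊤),
      w ^ 2 = cubic l (pull (ovMap f) a) ∧ IsUnit (w + const (ov V) c)) ∧ IsNisnevichAt f u := by
  have h2 : IsUnit (2 : Γ((ov U).left, ⊤)) := by
    rw [← map_ofNat (const (ov U)) 2]
    exact (two_ne_zero (α := ℂ)).isUnit.map _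
  obtain ⟨V, f, ⟨w, hw, hu⟩, hf⟩ := exists_sqrt_res (U := U) u h2 (cubic l a) (const (ov U) c)
    (ev u (const (ov U) c)) (by
      change _ = ev u (cubic l a)
      rw [ev_cubic ha, ← hc, map_pow, map_pow]
      rfl) (ev_const_ne_zero u hc0) (by
      change ev u (const (ov U) c) + ev u (const (ov U) c) ≠ 0
      rw [← map_add, ← map_add]
      exact ev_const_ne_zero u (by simpa using hc0))
  refine ⟨V, f, ⟨w, hw.trans (pull_cubic l (ovMap f) a), ?_⟩, hf⟩
  rw [← pull_const (ovMap f)]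
  exact hu

/-- The projection `𝔸¹ × U ⟶ U`. -/
def lineProj (U : Sm ℂ) : lineTimes U ⟶ U :=
  MorphismProperty.Over.homMk (𝔸(PUnit.{1}; U.left) ↘ U.left) rfl trivial

lemma lineSection_lineProj (U : Sm ℂ) (t : ℂ) : lineSection U t ≫ lineProj U = 𝟙 U := by
  apply MorphismProperty.Over.Hom.ext
  exact AffineSpace.homOfVector_over _ _

/-- The coordinate function on `𝔸¹ × U`. -/
def lineCoord (U : Sm ℂ) : Γ((ov (lineTimes U)).left, ⊤) :=
  AffineSpace.coord U.left PUnit.unit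

lemma pull_lineCoord (U : Sm ℂ) (t : ℂ) :
    pull (ovMap (lineSection U t)) (lineCoord U) = const (ov U) t :=
  AffineSpace.homOfVector_appTop_coord _ _ _

lemma pull_lineProj (U : Sm ℂ) (t : ℂ) (a : Γ((ov U).left, ⊤)) :
    pull (ovMap (lineSection U t)) (pull (ovMap (lineProj U)) a) = a := by
  rw [← pull_comp, ← ovMap_comp, lineSection_lineProj, ovMap_id, pull_id]

lemma map_lineProj {n : ℕ} (U : Sm ℂ) (t : ℂ) (p : Chain l n (ov U)) :
    (p.map (ovMap (lineProj U))).map (ovMap (lineSection U t)) = p := by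
  rw [← Chain.map_comp, ← ovMap_comp, lineSection_lineProj, ovMap_id, Chain.map_id]

/-! ### Homotopy classes of chains with a parameter -/

variable (l) in
/-- The presheaf `G × Xₙ`, with sections of `Xₙ` given by their coordinates. -/
def withParam (G : (Sm ℂ)ᵒᵖ ⥤ Type 1) (n : ℕ) : (Sm ℂ)ᵒᵖ ⥤ Type 1 where
  obj U := G.obj U × Chain l n (ov U.unop)
  map f := TypeCat.ofHom fun s => (G.map f s.1, s.2.map (ovMap f.unop))
  map_id U := by
    refine ConcreteCategory.hom_ext (C := Type 1) _ _ ?_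
    rintro ⟨g, p⟩
    exact Prod.ext (ConcreteCategory.congr_hom (G.map_id U) g)
      ((congrArg (fun f => p.map f) (ovMap_id U.unop)).trans p.map_id)
  map_comp f f' := by
    refine ConcreteCategory.hom_ext (C := Type 1) _ _ ?_
    rintro ⟨g, p⟩
    exact Prod.ext (ConcreteCategory.congr_hom (G.map_comp f f') g)
      ((congrArg (fun f => p.map f) (ovMap_comp f'.unop f.unop)).trans (p.map_comp _ _))

/-- The presheaf `G × 𝔾ₘ`. -/
def withUnit (G : (Sm ℂ)ᵒᵖ ⥤ Type 1) : (Sm ℂ)ᵒᵖ ⥤ Type 1 where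
  obj U := G.obj U × Γ((ov U.unop).left, ⊤)ˣ
  map f := TypeCat.ofHom fun s => (G.map f s.1, Units.map (pull (ovMap f.unop)).toMonoidHom s.2)
  map_id U := by
    refine ConcreteCategory.hom_ext (C := Type 1) _ _ ?_
    rintro ⟨g, a⟩
    exact Prod.ext (ConcreteCategory.congr_hom (G.map_id U) g)
      (Units.ext ((congrArg (fun f => pull f (a : Γ((ov U.unop).left, ⊤)))
        (ovMap_id U.unop)).trans (pull_id _ _)))
  map_comp {U _ _} f f' := by
    refine ConcreteCategory.hom_ext (C := Type 1) _ _ ?_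
    rintro ⟨g, a⟩
    exact Prod.ext (ConcreteCategory.congr_hom (G.map_comp f f') g)
      (Units.ext ((congrArg (fun f => pull f (a : Γ((ov U.unop).left, ⊤)))
        (ovMap_comp f'.unop f.unop)).trans (pull_comp _ _ _)))

variable {G : (Sm ℂ)ᵒᵖ ⥤ Type 1} {n : ℕ}

/-- The class in `𝒮(G × Xₙ)` of a parameter and a chain of coordinates. -/
def cls {U : Sm ℂ} (g : G.obj (op U)) (p : Chain l n (ov U)) :
    (naiveComponents (withParam l G n)).obj (op U) :=
  (toNaive (withParam l G n)).app (op U) ((g, p) : G.obj (op U) × Chain l n (ov U))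

lemma map_cls {U V : Sm ℂ} (f : V ⟶ U) (g : G.obj (op U)) (p : Chain l n (ov U)) :
    (naiveComponents (withParam l G n)).map f.op (cls g p) =
      cls (G.map f.op g) (p.map (ovMap f)) :=
  (NatTrans.naturality_apply (toNaive (withParam l G n)) f.op
    ((g, p) : G.obj (op U) × Chain l n (ov U))).symm

/-- The parameter is pulled back along the projection, hence constant in the homotopy. -/
lemma cls_eq_of_homotopy {U : Sm ℂ} (g : G.obj (op U)) (H : Chain l n (ov (lineTimes U))) :
    cls g (H.map (ovMap (lineSection U 0))) = cls g (H.map (ovMap (lineSection U 1))) := by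
  have key (t : ℂ) : G.map (lineSection U t).op (G.map (lineProj U).op g) = g := by
    rw [← ConcreteCategory.comp_apply, ← G.map_comp, ← op_comp, lineSection_lineProj, op_id,
      G.map_id]
    rfl
  exact toNaive_eq_of_isHomotopic ⟨(G.map (lineProj U).op g, H),
    Prod.ext (key 0) rfl, Prod.ext (key 1) rfl⟩

/-- Points of the affine line are joined by a straight line. -/
lemma cls_eq_zero_dim {U : Sm ℂ} (g : G.obj (op U)) (p q : Chain l 0 (ov U)) :
    cls g p = cls g q := by
  let H : Chain l 0 (ov (lineTimes U)) :=
    { x := fun i => pull (ovMap (lineProj U)) (p.x i) +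
        lineCoord U * pull (ovMap (lineProj U)) (q.x i - p.x i)
      y := Fin.elim0
      eq := fun i => i.elim0
      ne_zero := fun i => i.elim0 }
  have h0 : H.map (ovMap (lineSection U 0)) = p := by
    refine Chain.ext (funext fun i => ?_) (funext fun i => i.elim0)
    change pull (ovMap (lineSection U 0)) (_ + _ * _) = _
    rw [map_add, map_mul, pull_lineProj, pull_lineProj, pull_lineCoord, map_zero, zero_mul,
      add_zero]
  have h1 : H.map (ovMap (lineSection U 1)) = q := by
    refine Chain.ext (funext fun i => ?_) (funext fun i => i.elim0)
    change pull (ovMap (lineSection U 1)) (_ + _ * _) = _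
    rw [map_add, map_mul, pull_lineProj, pull_lineProj, pull_lineCoord, map_one, one_mul,
      add_sub_cancel]
  rw [← h0, ← h1]
  exact cls_eq_of_homotopy g H

/-- Where `x₁` is invertible, the class of a chain does not depend on `x₀` and `y₁`. -/
lemma cls_eq_of_isUnit {U : Sm ℂ} (g : G.obj (op U)) {p q : Chain l (n + 1) (ov U)}
    (h : p.tail = q.tail) (hp : IsUnit (p.tail.x 0)) : cls g p = cls g q := by
  have hx (t : (ov U).left) : ev t (p.tail.x 0) ≠ 0 := (isUnit_iff_ev_ne_zero _).1 hp t
  -- The pair `(0, 0)` is allowed in front precisely because the next coordinate vanishes nowhere.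
  let p₀ : Chain l (n + 1) (ov U) := p.tail.cons 0 0 (by simp) (fun t => Or.inr (hx t))
  have key (r : Chain l (n + 1) (ov U)) (hr : r.tail = p.tail) : cls g p₀ = cls g r := by
    -- Scaling `(x₀, y₁)` by the coordinate of `𝔸¹` preserves the equation, which is homogeneous of
    -- degree two in this pair.
    let H : Chain l (n + 1) (ov (lineTimes U)) :=
      (r.tail.map (ovMap (lineProj U))).cons
        (lineCoord U * pull (ovMap (lineProj U)) (r.x 0))
        (lineCoord U * pull (ovMap (lineProj U)) (r.y 0)) (by
          rw [mul_pow, mul_pow, ← map_pow, r.eq 0, map_mul, map_pow, pull_cubic, mul_assoc]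
          rfl) (fun t => Or.inr (by
          rw [hr]
          change ev t (pull _ (p.tail.x 0)) ≠ 0
          rw [ne_eq, ev_pull_eq_zero_iff]
          exact hx _))
    have hT : H.tail = r.tail.map (ovMap (lineProj U)) := Chain.tail_cons _ _ _ _ _
    have hH (t : ℂ) : (H.map (ovMap (lineSection U t))).tail = r.tail :=
      (congrArg (Chain.map (ovMap (lineSection U t))) hT).trans (map_lineProj U t r.tail)
    have h0 : H.map (ovMap (lineSection U 0)) = p₀ := by
      refine Chain.ext_cons ?_ ?_ ((hH 0).trans (hr.trans (Chain.tail_cons _ _ _ _ _).symm))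
      · change pull (ovMap (lineSection U 0)) (_ * _) = 0
        rw [map_mul, pull_lineCoord, map_zero, zero_mul]
      · change pull (ovMap (lineSection U 0)) (_ * _) = 0
        rw [map_mul, pull_lineCoord, map_zero, zero_mul]
    have h1 : H.map (ovMap (lineSection U 1)) = r := by
      refine Chain.ext_cons ?_ ?_ (hH 1)
      · change pull (ovMap (lineSection U 1)) (_ * _) = _
        rw [map_mul, pull_lineCoord, pull_lineProj, map_one, one_mul]
      · change pull (ovMap (lineSection U 1)) (_ * _) = _
        rw [map_mul, pull_lineCoord, pull_lineProj, map_one, one_mul]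
    rw [← h0, ← h1]
    exact cls_eq_of_homotopy g H
  exact (key p rfl).symm.trans (key q h.symm)

/-! ### Prolongations and the inductive step -/

/-- The condition that `p` prolongs `q`, and where `x₁` may vanish does so with `x₀ = a` and with
`y₁ / x₀` on the branch of the square root of the cubic given by `c`. -/
def Prolongs (c : ℂ) {T : Over base} (a : Γ(T.left, ⊤)) (q : Chain l n T)
    (p : Chain l (n + 1) T) : Prop :=
  p.tail = q ∧ (IsUnit (q.x 0) ∨ p.x 0 = a ∧ ∃ w, p.y 0 = a * w ∧ w ^ 2 = cubic l (q.x 0) ∧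
    IsUnit (w + const T c))

lemma Prolongs.map {c : ℂ} {T T' : Over base} {a : Γ(T.left, ⊤)} {q : Chain l n T}
    {p : Chain l (n + 1) T} (h : Prolongs c a q p) (f : T' ⟶ T) :
    Prolongs c (pull f a) (q.map f) (p.map f) := by
  obtain ⟨rfl, h⟩ := h
  refine ⟨rfl, h.imp (fun h => h.map _) ?_⟩
  rintro ⟨h, w, hy, hw, hu⟩
  refine ⟨congrArg (pull f) h, pull f w, ?_, ?_, ?_⟩
  · change pull f (p.y 0) = _
    rw [hy, map_mul]
  · rw [← map_pow, hw, pull_cubic]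
    rfl
  · rw [← pull_const f, ← map_add]
    exact hu.map _

/-- Near a zero of `x₁` the two prolongations coincide, since the root with value `c` is unique
there; elsewhere they are homotopic. Being sections of a sheaf, their classes agree. -/
lemma cls_eq_of_prolongs {c : ℂ} (hc0 : c ≠ 0) (hc : c ^ 2 = ∏ j, -l j) {U : Sm ℂ}
    (g : G.obj (op U)) {a : Γ((ov U).left, ⊤)} {q : Chain l n (ov U)}
    {p p' : Chain l (n + 1) (ov U)} (h : Prolongs c a q p) (h' : Prolongs c a q p') :
    cls g p = cls g p' := by
  obtain ⟨rfl, h⟩ := h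
  obtain ⟨ht, h'⟩ := h'
  rcases h with h | ⟨hx, w, hy, hw, hu⟩
  · exact cls_eq_of_isUnit g ht.symm h
  rcases h' with h' | ⟨hx', w', hy', hw', hu'⟩
  · exact cls_eq_of_isUnit g ht.symm h'
  refine eq_of_locally_eq (isSheaf_naiveComponents _) _ _ fun u => ?_
  change (ov U).left at u
  by_cases h0 : ev u (p.tail.x 0) = 0
  · have hroot {v : Γ((ov U).left, ⊤)} (hv : v ^ 2 = cubic l (p.tail.x 0))
        (hvu : IsUnit (v + const (ov U) c)) : ev u v = ev u (const (ov U) c) := by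
      have h₁ := congrArg (ev u) hv
      rw [ev_cubic h0, ← hc, map_pow, map_pow, map_pow] at h₁
      refine (sq_eq_sq_iff_eq_or_eq_neg.1 h₁).resolve_right fun h₂ => ?_
      refine (isUnit_iff_ev_ne_zero _).1 hvu u ?_
      rw [map_add, h₂, neg_add_cancel]
    -- Both roots have value `c` at `u`, so `w + w'` has value `2c ≠ 0` and is invertible nearby;
    -- `(w + w')(w - w') = 0` then gives `w = w'`.
    obtain ⟨V, f, hV, hf⟩ := exists_isUnit_pull u (w + w') (by
      rw [map_add, hroot hw hu, hroot hw' hu', ← map_add, ← map_add]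
      exact ev_const_ne_zero u (by simpa using hc0))
    refine ⟨V, f, ?_, hf⟩
    have hww : pull (ovMap f) w = pull (ovMap f) w' := by
      rw [← sub_eq_zero, ← map_sub, ← hV.mul_right_eq_zero, ← map_mul]
      rw [show (w + w') * (w - w') = w ^ 2 - w' ^ 2 by ring, hw, hw', sub_self, map_zero]
    rw [map_cls, map_cls]
    congr 1
    refine Chain.ext_cons ?_ ?_ (congrArg (Chain.map (ovMap f)) ht.symm)
    · change pull (ovMap f) (p.x 0) = pull (ovMap f) (p'.x 0)
      rw [hx, hx']
    · change pull (ovMap f) (p.y 0) = pull (ovMap f) (p'.y 0)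
      rw [hy, hy', map_mul, map_mul, hww]
  · obtain ⟨V, f, hV, hf⟩ := exists_isUnit_pull u _ h0
    refine ⟨V, f, ?_, hf⟩
    rw [map_cls, map_cls]
    exact cls_eq_of_isUnit _ (congrArg (Chain.map (ovMap f)) ht.symm) hV

/-- At a zero of `x₁` the pair `(a, a w)` is put in front, with `w` a local root near `c`; at other
points `(0, 0)` works. -/
lemma exists_prolongs {c : ℂ} (hc0 : c ≠ 0) (hc : c ^ 2 = ∏ j, -l j) {U : Sm ℂ}
    (a : Γ((ov U).left, ⊤)ˣ) (q : Chain l n (ov U)) (u : U.left) :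
    ∃ (V : Sm ℂ) (f : V ⟶ U), (∃ p, Prolongs c (pull (ovMap f) a) (q.map (ovMap f)) p) ∧
      IsNisnevichAt f u := by
  change (ov U).left at u
  by_cases h0 : ev u (q.x 0) = 0
  · obtain ⟨V, f, ⟨w, hw, hu⟩, hf⟩ := exists_sqrt_pull hc0 hc u _ h0
    refine ⟨V, f, ⟨(q.map (ovMap f)).cons (pull (ovMap f) a) (pull (ovMap f) a * w) ?_ ?_,
      Chain.tail_cons _ _ _ _ _, Or.inr ⟨rfl, w, rfl, hw, hu⟩⟩, hf⟩
    · rw [mul_pow, hw]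
      rfl
    · exact fun t => Or.inl ((isUnit_iff_ev_ne_zero _).1 (a.isUnit.map _) t)
  · obtain ⟨V, f, hV, hf⟩ := exists_isUnit_pull u _ h0
    exact ⟨V, f, ⟨(q.map (ovMap f)).cons 0 0 (by simp)
      (fun t => Or.inr ((isUnit_iff_ev_ne_zero _).1 hV t)), Chain.tail_cons _ _ _ _ _,
      Or.inl hV⟩, hf⟩

/-- The morphism `G × 𝔾ₘ × Xₙ ⟶ 𝒮(G × Xₙ₊₁)` sending a chain of coordinates to the class of its
local prolongations. -/
lemma exists_prolongation_hom {c : ℂ} (hc0 : c ≠ 0) (hc : c ^ 2 = ∏ j, -l j)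
    (G : (Sm ℂ)ᵒᵖ ⥤ Type 1) (n : ℕ) :
    ∃ σ : withParam l (withUnit G) n ⟶ naiveComponents (withParam l G (n + 1)),
      ∀ {U : Sm ℂ} (g : G.obj (op U)) (a : Γ((ov U).left, ⊤)ˣ) (q : Chain l n (ov U))
        (p : Chain l (n + 1) (ov U)), Prolongs c (a : Γ((ov U).left, ⊤)) q p →
        σ.app (op U) ((g, a), q) = cls g p := by
  let R (U : Sm ℂ) (s : (withParam l (withUnit G) n).obj (op U))
      (t : (naiveComponents (withParam l G (n + 1))).obj (op U)) : Prop :=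
    ∃ p, Prolongs c (s.1.2 : Γ((ov U).left, ⊤)) s.2 p ∧ cls s.1.1 p = t
  have hR {U V : Sm ℂ} (f : V ⟶ U) (x : (withParam l (withUnit G) n).obj (op U))
      (s : (naiveComponents (withParam l G (n + 1))).obj (op U)) (h : R U x s) :
      R V ((withParam l (withUnit G) n).map f.op x)
        ((naiveComponents (withParam l G (n + 1))).map f.op s) := by
    obtain ⟨p, hp, rfl⟩ := h
    exact ⟨_, hp.map (ovMap f), (map_cls f _ _).symm⟩
  obtain ⟨σ, hσ⟩ := exists_hom_of_rel (isSheaf_naiveComponents (withParam l G (n + 1))) R hR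
    (by
      rintro U x _ _ ⟨p, hp, rfl⟩ ⟨p', hp', rfl⟩
      exact cls_eq_of_prolongs hc0 hc _ hp hp')
    (by
      intro U x
      let S : Sieve U :=
        { arrows := fun V f => ∃ s, R V ((withParam l (withUnit G) n).map f.op x) s
          downward_closed := by
            rintro V W f ⟨s, hs⟩ g
            have := hR g _ _ hs
            rw [← ConcreteCategory.comp_apply, ← Functor.map_comp, ← op_comp] at this
            exact ⟨_, this⟩ }
      refine ⟨S, fun u => ?_, fun f hf => hf⟩
      obtain ⟨V, f, ⟨p, hp⟩, hf⟩ := exists_prolongs hc0 hc x.1.2 x.2 u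
      exact ⟨V, f, ⟨_, p, hp, rfl⟩, hf⟩)
  exact ⟨σ, fun g a q p hp => hσ _ _ ⟨p, hp, rfl⟩⟩

/-- Locally, every chain is a prolongation of its tail for a suitable unit and branch of the
square root. -/
lemma exists_prolongs_tail (hl : ∀ i, l i ≠ 0) {U : Sm ℂ} (p : Chain l (n + 1) (ov U))
    (u : U.left) :
    ∃ (V : Sm ℂ) (f : V ⟶ U), (∃ (c : ℂ) (a : Γ((ov V).left, ⊤)ˣ), c ≠ 0 ∧ c ^ 2 = ∏ j, -l j ∧
      Prolongs c (a : Γ((ov V).left, ⊤)) (p.tail.map (ovMap f)) (p.map (ovMap f))) ∧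
      IsNisnevichAt f u := by
  change (ov U).left at u
  obtain ⟨c, hc⟩ : ∃ c : ℂ, c ^ 2 = ∏ j, -l j := IsAlgClosed.exists_pow_nat_eq _ two_pos
  have hc0 {c : ℂ} (hc : c ^ 2 = ∏ j, -l j) : c ≠ 0 := by
    rintro rfl
    rw [zero_pow two_ne_zero, eq_comm, Finset.prod_eq_zero_iff] at hc
    obtain ⟨j, -, hj⟩ := hc
    exact hl j (neg_eq_zero.1 hj)
  by_cases h0 : ev u (p.tail.x 0) = 0
  · have hx : ev u (p.x 0) ≠ 0 := (p.ne_zero 0 u).resolve_right (fun h => h h0)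
    obtain ⟨z, hz⟩ : ∃ z : (ov U).left.residueField u, ev u (p.y 0) = ev u (p.x 0) * z :=
      ⟨ev u (p.y 0) / ev u (p.x 0), (mul_div_cancel₀ _ hx).symm⟩
    have hz2 : z ^ 2 = ev u (const (ov U) c) ^ 2 := by
      have h₁ := congrArg (ev u) (p.eq 0)
      rw [map_pow, hz, map_mul, map_pow, mul_pow] at h₁
      have h₂ := mul_left_cancel₀ (pow_ne_zero 2 hx) h₁
      refine h₂.trans ((ev_cubic h0).trans ?_)
      rw [← hc, map_pow, map_pow]
    -- The ratio `z = y₁/x₀` at `u` squares to `f(0)`, so it is one of two complex constants; the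
    -- sign of `c` is chosen to match.
    obtain ⟨c, hc, hzc⟩ : ∃ c : ℂ, c ^ 2 = ∏ j, -l j ∧ z = ev u (const (ov U) c) := by
      rcases sq_eq_sq_iff_eq_or_eq_neg.1 hz2 with h | h
      · exact ⟨c, hc, h⟩
      · exact ⟨-c, by rw [neg_sq, hc], by rw [h, map_neg, map_neg]⟩
    -- One neighbourhood inverts both `x₀`, which becomes `a`, and `y₁ + c x₀ = x₀ (w + c)` for `w =
    -- y₁/x₀`.
    obtain ⟨V, f, hV, hf⟩ := exists_isUnit_pull u
      (p.x 0 * (p.y 0 + p.x 0 * const (ov U) c)) (by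
        rw [map_mul, map_add, map_mul, hz, hzc, ← mul_add, ← map_add, ← map_add]
        exact mul_ne_zero hx (mul_ne_zero hx (ev_const_ne_zero u (by simpa using hc0 hc))))
    rw [map_mul, IsUnit.mul_iff] at hV
    obtain ⟨⟨a, ha⟩, hV⟩ := hV
    have hy : pull (ovMap f) (p.y 0) = a * (↑a⁻¹ * pull (ovMap f) (p.y 0)) :=
      (a.mul_inv_cancel_left _).symm
    refine ⟨V, f, ⟨c, a, hc0 hc, hc, rfl, Or.inr ⟨ha.symm, _, hy, ?_, ?_⟩⟩, hf⟩
    · have h₁ := congrArg (pull (ovMap f)) (p.eq 0)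
      rw [map_mul, map_pow, map_pow, pull_cubic] at h₁
      change _ = pull (ovMap f) (p.x 0) ^ 2 * _ at h₁
      rw [← ha, hy, mul_pow] at h₁
      exact (a.isUnit.pow 2).mul_left_cancel h₁
    · refine isUnit_of_mul_isUnit_right (x := (a : Γ((ov V).left, ⊤))) ?_
      rw [mul_add, ← hy, ha, ← pull_const (ovMap f), ← map_mul, ← map_add]
      exact hV
  · obtain ⟨V, f, hV, hf⟩ := exists_isUnit_pull u _ h0
    -- Where `x₁` is invertible any unit and either root will do.
    exact ⟨V, f, ⟨c, 1, hc0 hc, hc, rfl, Or.inl hV⟩, hf⟩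

/-- Constant chains with every `yᵢ` a fixed square root `d` of `f(1)`; they serve as common
reference points because their `x₁` is invertible. -/
lemma exists_base_chains (l : Fin 3 → ℂ) :
    ∃ e : ∀ (n : ℕ) (T : Over base), Chain l n T,
      (∀ n T i, (e n T).x i = 1) ∧ (∀ n T, (e (n + 1) T).tail = e n T) ∧
      ∀ n {T T' : Over base} (f : T' ⟶ T), (e n T).map f = e n T' := by
  obtain ⟨d, hd⟩ : ∃ d : ℂ, d ^ 2 = ∏ j, (1 - l j) := IsAlgClosed.exists_pow_nat_eq _ two_pos
  refine ⟨fun n T => ⟨fun _ => 1, fun _ => const T d, fun i => ?_, fun i t => ?_⟩,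
    fun _ _ _ => rfl, fun _ _ => rfl, fun n T T' f => ?_⟩
  · rw [← map_pow, hd, map_prod, one_pow, one_mul, cubic]
    simp
  · simp
  · ext
    · simp
    · simp [pull_const]

/-- Two sections of `G × Xₙ` with the same parameter become equal in `𝒮ⁿ⁺¹(G × Xₙ)`. -/
theorem toNaiveIter_eq (hl : ∀ i, l i ≠ 0) (n : ℕ) (G : (Sm ℂ)ᵒᵖ ⥤ Type 1) {U : Sm ℂ}
    (g : G.obj (op U)) (p q : Chain l n (ov U)) :
    (toNaiveIter n (naiveComponents (withParam l G n))).app (op U) (cls g p) =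
      (toNaiveIter n (naiveComponents (withParam l G n))).app (op U) (cls g q) := by
  obtain ⟨e, he, het, hem⟩ := exists_base_chains l
  induction n generalizing G U with
  | zero => rw [cls_eq_zero_dim g p q]
  | succ n ih =>
    suffices h : ∀ p : Chain l (n + 1) (ov U),
        (toNaiveIter (n + 1) (naiveComponents (withParam l G (n + 1)))).app (op U) (cls g p) =
        (toNaiveIter (n + 1) (naiveComponents (withParam l G (n + 1)))).app (op U)
          (cls g (e _ _)) from (h p).trans (h q).symm
    intro p
    refine eq_of_locally_eq (isSheaf_naiveIter n _) _ _ fun u => ?_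
    obtain ⟨V, f, ⟨c, a, hc0, hc, hp⟩, hf⟩ := exists_prolongs_tail hl p u
    refine ⟨V, f, ?_, hf⟩
    rw [← NatTrans.naturality_apply, ← NatTrans.naturality_apply, map_cls, map_cls, hem]
    obtain ⟨σ, hσ⟩ := exists_prolongation_hom hc0 hc G n
    -- Both classes become values of the same `σ` with the same parameter `(g, a)`, so only the
    -- tails differ and the induction hypothesis for `withUnit G` applies.
    rw [← hσ _ a _ _ hp, ← hσ _ a (e n _) (e (n + 1) _) ⟨het _ _, Or.inl (by simp [he])⟩]
    exact (naiveIterMap_toNaiveIter_apply (n + 1) σ _).symm.trans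
      ((congrArg _ (ih (withUnit G) _ _ _)).trans (naiveIterMap_toNaiveIter_apply (n + 1) σ _))

end Connectedness

/-! ### Sections over smooth schemes and values at fields -/

section Values

variable {l : Fin 3 → ℂ}

/-- The sheaf `𝒮ⁿ⁺¹(Xₙ)` has exactly one section over every smooth scheme. -/
lemma exists_unique_section (hl : ∀ i, l i ≠ 0) (n : ℕ) (U : Sm ℂ) :
    ∃ s, ∀ t : (naiveComponents^[n + 1] (functorOfPoints (X l n))).obj (op U), t = s := by
  obtain ⟨α, -, hα, -, hαn, -⟩ := exists_chain_bijection l n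
  obtain ⟨e, -⟩ := exists_base_chains l
  let G : (Sm ℂ)ᵒᵖ ⥤ Type 1 := (Functor.const _).obj PUnit
  let γ : withParam l G n ⟶ functorOfPoints (X l n) :=
    { app := fun V => TypeCat.ofHom fun s => ⟨α _ s.2⟩
      naturality := fun V W f => by
        ext ⟨g, p⟩
        exact congrArg ULift.up (hαn (ovMap f.unop) p) }
  have hγ (V : Sm ℂ) (x y : (functorOfPoints (X l n)).obj (op V)) :
      (toNaiveIter (n + 1) (functorOfPoints (X l n))).app (op V) x =
        (toNaiveIter (n + 1) (functorOfPoints (X l n))).app (op V) y := by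
    obtain ⟨x⟩ := x
    obtain ⟨y⟩ := y
    obtain ⟨p, rfl⟩ := (hα _).2 x
    obtain ⟨q, rfl⟩ := (hα _).2 y
    refine (naiveIterMap_toNaiveIter_apply (n + 1) γ (PUnit.unit, p)).symm.trans
      (Eq.trans ?_ (naiveIterMap_toNaiveIter_apply (n + 1) γ (PUnit.unit, q)))
    exact congrArg _ (toNaiveIter_eq hl n G PUnit.unit p q)
  let x₀ : (functorOfPoints (X l n)).obj (op U) := ⟨α _ (e n _)⟩
  refine ⟨(toNaiveIter (n + 1) (functorOfPoints (X l n))).app (op U) x₀, fun t => ?_⟩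
  refine eq_of_locally_eq (isSheaf_naiveIter n _) _ _ fun u => ?_
  -- Locally `t` comes from a genuine point of `Xₙ`, and all such points have the same image.
  obtain ⟨V, f, ⟨y, hy⟩, hf⟩ :=
    Presheaf.imageSieve_mem (nisnevich ℂ) (toNaiveIter (n + 1) (functorOfPoints (X l n)))
      (U := op U) t u
  refine ⟨V, f, ?_, hf⟩
  rw [← hy, ← NatTrans.naturality_apply]
  exact hγ V _ _

/-- The point `Spec ℂ` as a smooth scheme. -/
def point : Sm ℂ := MorphismProperty.Over.mk ⊤ (𝟙 base) ⟨inferInstance, inferInstance⟩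

/-- `Spec ℂ` is itself an index of the colimit and receives a map from every other index. As each
`F(U)` is a singleton, every element is a restriction of the section over `Spec ℂ`. -/
lemma valueAtField_unique {F : (Sm ℂ)ᵒᵖ ⥤ Type 1}
    (hF : ∀ U : Sm ℂ, ∃ s, ∀ t : F.obj (op U), t = s) (k : Type) [Field k] [Algebra ℂ k] :
    Nonempty (Unique (valueAtField F k)) := by
  let D := (StructuredArrow.proj
    (Over.mk (Spec.map (CommRingCat.ofHom (algebraMap ℂ k)))) (Sm.incl ℂ)).op ⋙ F
  let j₀ : StructuredArrow (Over.mk (Spec.map (CommRingCat.ofHom (algebraMap ℂ k))))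
      (Sm.incl ℂ) :=
    StructuredArrow.mk (Y := point) (Over.homMk (Spec.map (CommRingCat.ofHom (algebraMap ℂ k)))
      (Category.comp_id _))
  obtain ⟨s, hs⟩ := hF point
  refine ⟨⟨⟨colimit.ι D (op j₀) s⟩, fun x => ?_⟩⟩
  obtain ⟨⟨j⟩, t, rfl⟩ := Types.jointly_surjective_of_isColimit (colimit.isColimit D) x
  let π : j ⟶ j₀ := StructuredArrow.homMk
    (MorphismProperty.Over.homMk j.right.hom (Category.comp_id _) trivial) (by
      apply Over.OverMorphism.ext
      exact Over.w j.hom)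
  have h : D.map π.op s = t := ((hF j.right).choose_spec _).trans ((hF j.right).choose_spec _).symm
  rw [← h]
  exact ConcreteCategory.congr_hom (colimit.w D π.op) s

end Values

end NaiveA1

end

theorem mainTheorem3 (l : Fin 3 → ℂ) (hl : ∀ i, l i ≠ 0) (n : ℕ) (hn : 1 ≤ n)
    (k : Type) [Field k] [Algebra ℂ k] (hk : (⊤ : IntermediateField ℂ k).FG) :
    Nonempty (Unique (NaiveA1.valueAtField
      (NaiveA1.naiveComponents^[n + 1] (NaiveA1.functorOfPoints (NaiveA1.X l n))) k)) :=
  NaiveA1.valueAtField_unique (NaiveA1.exists_unique_section hl n) k
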